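/- Let $X$ be a separable complex Hilbert space and let $A : D(A) \subset X \to X$ be the infinitesimal generator of an exponentially stable $C_0$-semigroup $(T(t))_{t\ge 0}$ on $X$, i.e. $\|T(t)\| \le M e^{-\omega t}$ for all $t \ge 0$ with some $M$ and some $\omega>0$. Let $\mathcal H_\infty^-$ be the algebra of bounded analytic functions on $\mathbb C^- = \{s : \operatorname{Re} s<0\}$, with the norm $\|g\|_\infty = \sup_{s\in\mathbb C^-}|g(s)|$. For $g \in \mathcal H_\infty^-$ and $f \in L^2((0,\infty);X)$ with Laplace transform $F$, put $M_g f = \mathcal L^{-1}(\Pi(gF))$, where $g$ and $F$ are identified with their boundary functions on the imaginary axis and $\Pi$ is the orthogonal projection of $L^2(i\mathbb R;X)$ onto the space $\mathcal H_2(X)$ of (boundary functions of) Laplace transforms of functions in $L^2((0,\infty);X)$. The operator $g(A)$ is the linear map $D(A)\to X$, bounded for the graph norm, such that $M_g(T(\cdot)x) = g(A)T(\cdot)x$ in $L^2((0,\infty);X)$ for all $x \in D(A)$. Suppose that $A$ is dissipative, i.e. $\langle x, Ax\rangle + \langle Ax, x\rangle \le 0$ for all $x\in D(A)$. Then $A$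 has a bounded $\mathcal H_\infty^-$-calculus: for every $g \in \mathcal H_\infty^-$ the operator $g(A)$ exists, is unique, and extends to a bounded operator on $X$, again denoted by $g(A)$; the map $g \mapsto g(A)$ is a unital algebra homomorphism from $\mathcal H_\infty^-$ to the bounded operators on $X$; and if $g(s) = 1/(a-s)$ with $\operatorname{Re} a>0$, then $g(A) = (aI-A)^{-1}$. Moreover, \[ \|g(A)\| \le \|g\|_\infty \qquad \text{for all } g\in\mathcal H_\infty^- . \] -/

import Mathlib

open MeasureTheory Filter Topology
open scoped NNReal ENNReal FourierTransform BoundedContinuousFunction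

noncomputable section

/-! ### Semigroups and generators -/

/-- A strongly continuous semigroup of bounded operators on `X`. -/
structure C0Semigroup (X : Type*) [NormedAddCommGroup X] [InnerProductSpace ℂ X] where
  /-- The operator `T(t)`. -/
  op : ℝ≥0 → X →L[ℂ] X
  op_zero : op 0 = ContinuousLinearMap.id ℂ X
  op_add : ∀ s t, op (s + t) = (op s).comp (op t)
  continuous_orbit : ∀ x, Continuous fun t => op t x

namespace C0Semigroup

variable {X : Type*} [NormedAddCommGroup X] [InnerProductSpace ℂ X]

/-- `A` is the infinitesimal generator of `T`: `x ∈ D(A)` and `A x = y` hold exactly when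
`(T(t) x - x) / t` tends to `y` as `t ↓ 0`. -/
def IsGenerator (T : C0Semigroup X) (A : X →ₗ.[ℂ] X) : Prop :=
  ∀ x y : X, (x, y) ∈ A.graph ↔
    Tendsto (fun t : ℝ≥0 => ((t : ℝ) : ℂ)⁻¹ • (T.op t x - x)) (𝓝[>] 0) (𝓝 y)

/-- `‖T(t)‖ ≤ M e^{-ω t}` for some `ω > 0`. -/
def IsExponentiallyStable (T : C0Semigroup X) : Prop :=
  ∃ M ω : ℝ, 0 < ω ∧ ∀ t : ℝ≥0, ‖T.op t‖ ≤ M * Real.exp (-ω * t)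

/-- The orbit `t ↦ T(t) x` on `(0, ∞)`, extended by zero to `ℝ`. -/
def orbit (T : C0Semigroup X) (x : X) : ℝ → X :=
  (Set.Ioi (0 : ℝ)).indicator fun t => T.op t.toNNReal x

theorem IsExponentiallyStable.memLp_orbit {T : C0Semigroup X} (hT : T.IsExponentiallyStable)
    (x : X) : MemLp (T.orbit x) 2 (volume : Measure ℝ) := by
  obtain ⟨M, ω, hω, hM⟩ := hT
  have hexp : MemLp (fun t : ℝ => (M * ‖x‖) * Real.exp (-ω * t)) 2
      (volume.restrict (Set.Ioi (0 : ℝ))) := by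
    refine MemLp.const_mul ?_ _
    rw [memLp_two_iff_integrable_sq (by fun_prop)]
    have h2 : IntegrableOn (fun t : ℝ => Real.exp (-(2 * ω) * t)) (Set.Ioi 0) :=
      exp_neg_integrableOn_Ioi 0 (by positivity)
    refine h2.congr (Eventually.of_forall fun t => ?_)
    simp only [← Real.exp_nat_mul]
    congr 1
    push_cast
    ring
  have hcont : Continuous fun t : ℝ => T.op t.toNNReal x :=
    (T.continuous_orbit x).comp continuous_real_toNNReal
  rw [orbit, memLp_indicator_iff_restrict measurableSet_Ioi]
  refine hexp.mono hcont.aestronglyMeasurable ?_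
  filter_upwards [ae_restrict_mem measurableSet_Ioi] with t ht
  have h1 := (T.op t.toNNReal).le_of_opNorm_le (hM t.toNNReal) x
  rw [Real.coe_toNNReal t (le_of_lt ht)] at h1
  calc ‖T.op t.toNNReal x‖ ≤ M * Real.exp (-ω * t) * ‖x‖ := h1
    _ = M * ‖x‖ * Real.exp (-ω * t) := by ring
    _ ≤ _ := Real.le_norm_self _

/-- The orbit `T(·) x` as an element of `L²(ℝ; X)` that vanishes on `(-∞, 0]`. -/
def orbitL2 (T : C0Semigroup X) (hT : T.IsExponentiallyStable) (x : X) :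
    Lp X 2 (volume : Measure ℝ) :=
  (hT.memLp_orbit x).toLp (T.orbit x)

end C0Semigroup

/-- `⟨x, A x⟩ + ⟨A x, x⟩ ≤ 0` for all `x ∈ D(A)` (the left-hand side is a real number). -/
def IsDissipativeOp {X : Type*} [NormedAddCommGroup X] [InnerProductSpace ℂ X]
    (A : X →ₗ.[ℂ] X) : Prop :=
  ∀ x : A.domain, (inner ℂ (x : X) (A x) + inner ℂ (A x) (x : X)).re ≤ 0

/-! ### Bounded analytic functions on the left half-plane -/

/-- The open left half-plane. -/
def leftHalfPlane : Set ℂ := {s | s.re < 0}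

open Classical in
/-- Extension by zero of a function on the open left half-plane. -/
def zeroExtend (g : leftHalfPlane →ᵇ ℂ) (s : ℂ) : ℂ :=
  if h : s ∈ leftHalfPlane then g ⟨s, h⟩ else 0

/-- The algebra of bounded analytic functions on the open left half-plane. Its norm is the
supremum norm over the half-plane. -/
def HInfMinus : Subalgebra ℂ (leftHalfPlane →ᵇ ℂ) where
  carrier := {g | DifferentiableOn ℂ (zeroExtend g) leftHalfPlane}
  mul_mem' {f g} hf hg := by
    refine (DifferentiableOn.mul hf hg).congr fun s hs => ?_
    simp [zeroExtend, hs]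
  add_mem' {f g} hf hg := by
    refine (DifferentiableOn.add hf hg).congr fun s hs => ?_
    simp [zeroExtend, hs]
  algebraMap_mem' c := by
    refine (differentiableOn_const (c := c)).congr fun s hs => ?_
    simp [zeroExtend, hs]

/-- `b` is the boundary function of `g` on the imaginary axis, in the frequency variable:
`b ξ = lim_{σ ↑ 0} g (σ + 2πiξ)` for almost every `ξ`. -/
def IsBoundaryFunction (g : HInfMinus) (b : Lp ℂ ∞ (volume : Measure ℝ)) : Prop :=
  ∀ᵐ ξ : ℝ, Tendsto
    (fun σ : ℝ => zeroExtend g.1 ((σ : ℂ) + 2 * (Real.pi : ℂ) * Complex.I * (ξ : ℂ)))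
    (𝓝[<] 0) (𝓝 (b ξ))

/-! ### The Toeplitz operator and the functional calculus -/

section Calculus

variable {X : Type*} [NormedAddCommGroup X] [InnerProductSpace ℂ X] [CompleteSpace X]

variable (X) in
/-- `L²((0, ∞); X)`, as the subspace of `L²(ℝ; X)` of functions that vanish on `(-∞, 0]`. -/
def L2Pos : Submodule ℂ (Lp X 2 (volume : Measure ℝ)) :=
  LinearMap.ker (LpToLpRestrictCLM ℝ X ℂ (volume : Measure ℝ) 2 (Set.Iic 0)).toLinearMap

instance : CompleteSpace (L2Pos X) :=
  (ContinuousLinearMap.isClosed_ker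
    (LpToLpRestrictCLM ℝ X ℂ (volume : Measure ℝ) 2 (Set.Iic 0))).completeSpace_coe

variable (X) in
/-- The Hardy space `H₂(X)` of Laplace transforms of functions in `L²((0, ∞); X)`, identified with
their boundary functions on the imaginary axis. The boundary function `ω ↦ F(iω)` of the Laplace
transform `F` of `f` is the Fourier transform of `f`, at the frequency `ξ = ω / 2π`. -/
def H2 : Submodule ℂ (Lp X 2 (volume : Measure ℝ)) :=
  (L2Pos X).map ((Lp.fourierTransformₗᵢ ℝ X).toLinearEquiv :
    Lp X 2 (volume : Measure ℝ) →ₗ[ℂ] Lp X 2 (volume : Measure ℝ))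

instance : (H2 X).HasOrthogonalProjection :=
  Submodule.HasOrthogonalProjection.map_linearIsometryEquiv (L2Pos X) (Lp.fourierTransformₗᵢ ℝ X)

/-- The Toeplitz operator `f ↦ 𝓛⁻¹ (Π (b F))`, where `F` is the Laplace transform of `f`, `b` a
bounded function on the imaginary axis and `Π` the orthogonal projection onto `H₂(X)`. -/
def toeplitz (b : Lp ℂ ∞ (volume : Measure ℝ)) (f : Lp X 2 (volume : Measure ℝ)) :
    Lp X 2 (volume : Measure ℝ) :=
  𝓕⁻ ((H2 X).starProjection (b • (𝓕 f : Lp X 2 (volume : Measure ℝ)) :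
    Lp X 2 (volume : Measure ℝ)))

/-- The linear map `C : D(A) → X` is the operator `g(A)`: it is bounded for the graph norm, and
`M_g (T(·) x) = C T(·) x` in `L²((0, ∞); X)` for every `x ∈ D(A)`, where `M_g` is the Toeplitz
operator of the boundary function of `g`. -/
def IsFunctionOfGenerator (A : X →ₗ.[ℂ] X) (T : C0Semigroup X) (hT : T.IsExponentiallyStable)
    (g : HInfMinus) (C : A.domain →ₗ[ℂ] X) : Prop :=
  (∃ K : ℝ, ∀ x : A.domain, ‖C x‖ ≤ K * (‖(x : X)‖ + ‖A x‖)) ∧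
  ∃ b : Lp ℂ ∞ (volume : Measure ℝ), IsBoundaryFunction g b ∧
    ∀ x : A.domain, ∀ᵐ t : ℝ, 0 < t →
      ∃ z : A.domain, (z : X) = T.op t.toNNReal x ∧ toeplitz b (T.orbitL2 hT x) t = C z

/-- `Φ` is a bounded calculus for the generator `A` of `T`: a unital algebra homomorphism from the
bounded analytic functions on the left half-plane to the bounded operators on `X`, where `Φ g`
extends `g(A)`, and `Φ g` is the inverse of `a - A` when `g(s) = 1 / (a - s)` with `Re a > 0`. -/
structure IsBoundedHInfCalculus (A : X →ₗ.[ℂ] X) (T : C0Semigroup X)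
    (hT : T.IsExponentiallyStable) (Φ : HInfMinus →ₐ[ℂ] (X →L[ℂ] X)) : Prop where
  extends_function : ∀ g : HInfMinus,
    IsFunctionOfGenerator A T hT g ((Φ g).toLinearMap ∘ₗ A.domain.subtype)
  resolvent : ∀ (a : ℂ) (g : HInfMinus), 0 < a.re → (∀ s : leftHalfPlane, g.1 s = (a - s)⁻¹) →
    (∀ x : A.domain, Φ g (a • (x : X) - A x) = x) ∧
      ∀ y : X, ∃ x : A.domain, (x : X) = Φ g y ∧ a • (x : X) - A x = y

end Calculus

end

/-! ### Boundary values of bounded analytic functions on the left half-plane -/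

/-! Write R(a) for the resolvent (a - A)⁻¹, realised as the Laplace transform of the semigroup
(`res`); exponential stability makes it bounded and continuous up to the imaginary axis. The
calculus is an integral over that axis against the Poisson form P(y,x)(ξ) = ⟨y, R(iω)x⟩ + ⟨R(iω)y,
x⟩, ω = 2πξ.

Norm bound. Dissipativity gives Re⟨R(a)x, x⟩ ≥ Re a ‖R(a)x‖², so P is a positive form at every ξ.
The Poisson integral formula at the point N, the bound N Re⟨R(N)x, x⟩ ≤ ‖x‖² and Fatou's lemma as N
→ ∞ give ∫ P(x,x) dξ ≤ ‖x‖². For g with boundary function b, the sesquilinear form ∫ b P(y,x) dξ is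
therefore bounded by ‖g‖∞ ‖y‖ ‖x‖ and defines g(A) with ‖g(A)‖ ≤ ‖g‖∞
(`exists_clm_inner_eq_integral`).

Identification. Since the inner product is conjugate linear in its first slot, s ↦ ⟨R(-s̄)y, x⟩ is
bounded and analytic on the left half-plane, with boundary values ⟨R(iω)y, x⟩. By Cauchy's theorem
this half of P contributes nothing when paired with g and enough decay, which yields ⟨y, g(A)R(a)x⟩
= ∫ b (a - iω)⁻¹ ⟨y, R(iω)x⟩ dξ (`inner_hInfCalc_res`). The right side is also the Laplace transform
at a of M_g(T(·)x), tested against y. Injectivity of the Laplace transform gives M_g(T(·)x) =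
g(A)T(·)x (`toeplitz_orbitL2`).

Algebra. By the previous step, Π(b R(iω)x) = g(A)R(iω)x. The part removed by Π is orthogonal to H₂,
hence also to conj(c (a - iω)⁻¹)y for every boundary function c. This gives multiplicativity on the
range of the resolvent, which is dense.

Analytic input: Fatou's theorem on boundary values (`ae_exists_tendsto_boundary`) and Cauchy's
theorem on the axis (`integral_boundary_eq_zero`). -/

theorem isOpen_leftHalfPlane : IsOpen leftHalfPlane :=
  isOpen_lt Complex.continuous_re continuous_const

theorem convex_leftHalfPlane : Convex ℝ leftHalfPlane :=
  convex_halfSpace_re_lt 0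

theorem ball_subset_leftHalfPlane (n : ℕ) :
    Metric.ball (-(n : ℂ)) n ⊆ leftHalfPlane := by
  intro s hs
  rw [Metric.mem_ball, dist_eq_norm, sub_neg_eq_add] at hs
  have := (Complex.abs_re_le_norm (s + n)).trans_lt hs
  rw [abs_lt] at this
  simp only [Complex.add_re, Complex.natCast_re] at this
  show s.re < 0
  linarith

theorem exists_mem_ball_of_mem_leftHalfPlane {s : ℂ} (hs : s ∈ leftHalfPlane) :
    ∃ n : ℕ, s ∈ Metric.ball (-(n : ℂ)) n := by
  have hs' : s.re < 0 := hs
  obtain ⟨n, hn⟩ := exists_nat_gt (Complex.normSq s / (-2 * s.re))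
  have hpos : 0 < -2 * s.re := by linarith
  rw [div_lt_iff₀ hpos] at hn
  have hn0 : (0 : ℝ) ≤ n := n.cast_nonneg
  refine ⟨n, ?_⟩
  rw [Metric.mem_ball, dist_eq_norm, sub_neg_eq_add]
  refine lt_of_pow_lt_pow_left₀ 2 hn0 ?_
  rw [Complex.sq_norm, Complex.normSq_apply]
  rw [Complex.normSq_apply] at hn
  simp only [Complex.add_re, Complex.natCast_re, Complex.add_im, Complex.natCast_im, add_zero]
  nlinarith

/-- The half-plane is the increasing union of the discs of centre -n and radius n. Analytic
functions have primitives on discs, and normalising them to vanish at -1, which lies in every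
nonempty disc of the family, makes them agree on overlaps. -/
theorem exists_primitive_leftHalfPlane {f : ℂ → ℂ} (hf : DifferentiableOn ℂ f leftHalfPlane) :
    ∃ G : ℂ → ℂ, ∀ s ∈ leftHalfPlane, HasDerivAt G (f s) s := by
  have hF : ∀ n : ℕ, ∃ F : ℂ → ℂ, F (-1) = 0 ∧
      ∀ s ∈ Metric.ball (-(n : ℂ)) n, HasDerivAt F (f s) s := fun n =>
    ((hf.mono (ball_subset_leftHalfPlane n)).isExactOn_ball).with_val_at _ _
  choose F hF0 hF using hF
  have hmem : ∀ n : ℕ, (Metric.ball (-(n : ℂ)) n).Nonempty → (-1 : ℂ) ∈ Metric.ball (-(n : ℂ)) n := by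
    intro n hn
    have hn0 : 0 < n := by
      have := Metric.nonempty_ball.1 hn
      exact_mod_cast this
    rw [Metric.mem_ball, dist_eq_norm]
    have h1 : (-1 - -(n : ℂ)) = (((n : ℝ) - 1 : ℝ) : ℂ) := by push_cast; ring
    have h2 : (1 : ℝ) ≤ n := by exact_mod_cast hn0
    rw [h1, Complex.norm_real, Real.norm_of_nonneg (by linarith)]
    linarith
  have hagree : ∀ m n : ℕ, ∀ s ∈ Metric.ball (-(m : ℂ)) m, s ∈ Metric.ball (-(n : ℂ)) n →
      F m s = F n s := by
    intro m n s hm hn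
    have := IsOpen.eqOn_of_deriv_eq (𝕜 := ℂ) (f := F m) (g := F n) (x := -1)
      (s := Metric.ball (-(m : ℂ)) m ∩ Metric.ball (-(n : ℂ)) n)
      (Metric.isOpen_ball.inter Metric.isOpen_ball)
      ((convex_ball _ _).inter (convex_ball _ _)).isPreconnected
      (fun z hz => (hF m z hz.1).differentiableAt.differentiableWithinAt)
      (fun z hz => (hF n z hz.2).differentiableAt.differentiableWithinAt)
      (fun z hz => by rw [(hF m z hz.1).deriv, (hF n z hz.2).deriv])
      ⟨hmem m ⟨s, hm⟩, hmem n ⟨s, hn⟩⟩ (by rw [hF0, hF0])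
    exact this ⟨hm, hn⟩
  choose! N hN using fun s hs => exists_mem_ball_of_mem_leftHalfPlane (s := s) hs
  refine ⟨fun s => F (N s) s, fun s hs => (hF (N s) s (hN s hs)).congr_of_eventuallyEq ?_⟩
  filter_upwards [Metric.isOpen_ball.mem_nhds (hN s hs)] with z hz
  exact hagree _ _ _ (hN z (ball_subset_leftHalfPlane _ hz)) hz

/-- A function on the closed left half-plane of linear growth, which is analytic inside and is
`o(s)` at the origin along the imaginary axis, is `o(s)` at the origin. -/
theorem norm_le_mul_norm_near_zero_of_boundary {h : ℂ → ℂ} {L : ℝ} (hc : Continuous h)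
    (hd : DifferentiableOn ℂ h leftHalfPlane) (hL : ∀ s, ‖h s‖ ≤ L * ‖s‖)
    (ho : ∀ ε > 0, ∃ δ > 0, ∀ y : ℝ, |y| < δ → ‖h (y * Complex.I)‖ ≤ ε * |y|) {ε : ℝ} (hε : 0 < ε) :
    ∃ ρ > 0, ∀ s : ℂ, s.re < 0 → ‖s‖ < ρ → ‖h s‖ ≤ ε * ‖s‖ := by
  obtain ⟨δ, hδ, hb⟩ := ho (ε / 2) (by positivity)
  have hL0 : 0 ≤ L := by
    have := (norm_nonneg _).trans (hL 1)
    simpa using this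
  -- N is chosen so large that on the imaginary axis, where |w| ≤ 1/δ and the hypothesis `ho` says
  -- nothing, the growth bound alone keeps `k` below ε/2.
  obtain ⟨N, hN0, hN⟩ : ∃ N : ℝ, 0 < N ∧ L / (δ * N) ≤ ε / 2 := by
    refine ⟨2 * L / (δ * ε) + 1, by positivity, ?_⟩
    rw [div_le_iff₀ (by positivity)]
    have : ε / 2 * (δ * (2 * L / (δ * ε) + 1)) = L + ε * δ / 2 := by field_simp
    rw [this]
    have := mul_pos hε hδ
    linarith
  -- The inversion s = -1/w moves the origin to infinity and the left half-plane to the right one.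
  -- The factor w²/(w + N) is comparable to 1/s near s = 0, so `k` plays the role of h(s)/s, and it
  -- stays bounded near w = 0.
  set k : ℂ → ℂ := fun w => h (-w⁻¹) * w ^ 2 / (w + N) with hk
  have hden : ∀ w : ℂ, 0 ≤ w.re → N ≤ ‖w + N‖ ∧ ‖w‖ ≤ ‖w + N‖ := by
    intro w hw
    constructor
    · refine le_trans ?_ (Complex.re_le_norm _)
      simpa using hw
    · refine le_of_sq_le_sq ?_ (norm_nonneg _)
      rw [Complex.sq_norm, Complex.sq_norm, Complex.normSq_apply, Complex.normSq_apply]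
      simp only [Complex.add_re, Complex.ofReal_re, Complex.add_im, Complex.ofReal_im, add_zero]
      nlinarith
  have hne : ∀ w : ℂ, 0 ≤ w.re → w + N ≠ 0 := fun w hw => by
    rw [← norm_pos_iff]; exact hN0.trans_le (hden w hw).1
  have hkb : ∀ w : ℂ, 0 ≤ w.re → ‖k w‖ ≤ L * ‖w‖ / ‖w + N‖ := by
    intro w hw
    rcases eq_or_ne w 0 with rfl | hw0
    · simp [hk]
    · have h1 : ‖h (-w⁻¹)‖ ≤ L * ‖w‖⁻¹ := by simpa using hL (-w⁻¹)
      have hw1 : 0 < ‖w‖ := norm_pos_iff.2 hw0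
      rw [hk]
      simp only [norm_div, norm_mul, norm_pow]
      refine div_le_div_of_nonneg_right ?_ (norm_nonneg _)
      calc ‖h (-w⁻¹)‖ * ‖w‖ ^ 2 ≤ L * ‖w‖⁻¹ * ‖w‖ ^ 2 := by gcongr
        _ = L * ‖w‖ := by field_simp
  have hkL : ∀ w : ℂ, 0 ≤ w.re → ‖k w‖ ≤ L := by
    intro w hw
    refine (hkb w hw).trans ?_
    have := hden w hw
    rw [div_le_iff₀ (hN0.trans_le this.1)]
    exact mul_le_mul_of_nonneg_left this.2 hL0
  have hkN : ∀ w : ℂ, 0 ≤ w.re → ‖k w‖ ≤ L / N * ‖w‖ := by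
    intro w hw
    refine (hkb w hw).trans ?_
    rw [div_mul_eq_mul_div]
    exact div_le_div_of_nonneg_left (by positivity) hN0 (hden w hw).1
  have hdiff : DiffContOnCl ℂ k {z | 0 < z.re} := by
    constructor
    · intro w hw
      have hw : 0 < w.re := hw
      have hw0 : w ≠ 0 := fun h0 => by simp [h0] at hw
      have h1 : DifferentiableAt ℂ h (-w⁻¹) := by
        refine hd.differentiableAt (isOpen_leftHalfPlane.mem_nhds ?_)
        show (-w⁻¹).re < 0
        rw [Complex.neg_re, Complex.inv_re, neg_lt_zero]
        exact div_pos hw (Complex.normSq_pos.2 hw0)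
      refine DifferentiableAt.differentiableWithinAt ?_
      refine DifferentiableAt.div (DifferentiableAt.mul ?_ (by fun_prop)) (by fun_prop)
        (hne w hw.le)
      exact h1.comp w (differentiableAt_inv hw0).neg
    · rw [Complex.closure_setOfPred_lt_re]
      intro w hw
      have hw : 0 ≤ w.re := hw
      rcases eq_or_ne w 0 with rfl | hw0
      · have hk0 : k 0 = 0 := by simp [hk]
        rw [ContinuousWithinAt, hk0]
        refine squeeze_zero_norm' (a := fun w => L / N * ‖w‖) ?_ ?_
        · filter_upwards [self_mem_nhdsWithin] with z hz using hkN z hz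
        · refine Tendsto.mono_left ?_ nhdsWithin_le_nhds
          have : Continuous fun w : ℂ => L / N * ‖w‖ := by fun_prop
          simpa using this.tendsto 0
      · refine ContinuousAt.continuousWithinAt ?_
        refine ContinuousAt.div (ContinuousAt.mul ?_ (by fun_prop)) (by fun_prop) (hne w hw)
        exact hc.continuousAt.comp (continuousAt_inv₀ hw0).neg
  have him : ∀ x : ℝ, ‖k (x * Complex.I)‖ ≤ ε / 2 := by
    intro x
    have hre : 0 ≤ ((x : ℂ) * Complex.I).re := by simp
    by_cases hx : |x| ≤ 1 / δ
    · refine (hkN _ hre).trans (le_trans ?_ hN)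
      have : ‖(x : ℂ) * Complex.I‖ = |x| := by simp
      rw [this]
      calc L / N * |x| ≤ L / N * (1 / δ) := by gcongr
        _ = L / (δ * N) := by field_simp
    · push Not at hx
      have hx0 : 0 < |x| := lt_trans (by positivity) hx
      have hxne : x ≠ 0 := abs_pos.1 hx0
      have h1 : -((x : ℂ) * Complex.I)⁻¹ = ((x⁻¹ : ℝ) : ℂ) * Complex.I := by
        push_cast
        rw [mul_inv, Complex.inv_I]; ring
      have h2 := hb x⁻¹ (by
        rw [abs_inv]
        rw [div_lt_iff₀ hδ] at hx
        rw [inv_lt_iff_one_lt_mul₀ hx0]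
        linarith)
      have hd := (hden _ hre)
      have hd2 : |x| ≤ ‖(x : ℂ) * Complex.I + N‖ := by simpa using hd.2
      simp only [hk, norm_div, norm_mul, norm_pow, h1]
      rw [div_le_iff₀ (hN0.trans_le hd.1)]
      have h3 : ‖(x : ℂ)‖ = |x| := by simp
      rw [h3, Complex.norm_I, mul_one]
      calc _ ≤ ε / 2 * |x⁻¹| * |x| ^ 2 := by gcongr
        _ = ε / 2 * |x| := by rw [abs_inv]; field_simp
        _ ≤ _ := by gcongr
  have hPL : ∀ w : ℂ, 0 ≤ w.re → ‖k w‖ ≤ ε / 2 := by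
    intro w hw
    -- Since `k` is bounded by `L`, the growth conditions hold trivially with exponent 0; the
    -- principle improves the bound to the boundary bound ε/2.
    refine PhragmenLindelof.right_half_plane_of_bounded_on_real hdiff ⟨0, by norm_num, 0, ?_⟩ ?_ him hw
    · refine Asymptotics.IsBigO.of_bound L ?_
      refine (eventually_inf_principal.2 (Eventually.of_forall fun z hz => ?_))
      simpa using hkL z (le_of_lt hz)
    · refine ⟨L, ?_⟩
      rw [eventually_map]
      filter_upwards [eventually_ge_atTop 0] with x hx
      exact hkL x (by simpa using hx)
  refine ⟨1 / N, by positivity, fun s hs hsN => ?_⟩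
  have hs0 : s ≠ 0 := fun h0 => by simp [h0] at hs
  have hwre : 0 ≤ (-s⁻¹).re := by
    rw [Complex.neg_re, Complex.inv_re, neg_nonneg]
    exact div_nonpos_of_nonpos_of_nonneg hs.le (Complex.normSq_nonneg _)
  have h1 := hPL (-s⁻¹) hwre
  -- Undoing the inversion. For |s| < 1/N the factor |Ns - 1| is at most 2, which turns ε/2 into ε.
  have h2 : h s = k (-s⁻¹) * (s * (N * s - 1)) := by
    have h3 := hne _ hwre
    have h4 : -s⁻¹ + (N : ℂ) = (N * s - 1) / s := by field_simp; ring
    have h5 : N * s - 1 ≠ 0 := fun h6 => h3 (by rw [h4, h6, zero_div])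
    simp only [hk, h4]
    simp only [inv_neg, inv_inv, neg_neg]
    field_simp
    rw [mul_comm s, mul_div_cancel_right₀ _ h5]
  rw [h2, norm_mul, norm_mul]
  have h6 : ‖(N : ℂ) * s - 1‖ ≤ 2 := by
    refine (norm_sub_le _ _).trans ?_
    rw [norm_mul, Complex.norm_real, Real.norm_of_nonneg hN0.le, norm_one]
    rw [lt_div_iff₀ hN0] at hsN
    linarith
  calc _ ≤ ε / 2 * (‖s‖ * 2) := by gcongr
    _ = ε * ‖s‖ := by ring

/-- **Fatou's theorem**: a bounded analytic function on the left half-plane has boundary values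
at almost every point of the imaginary axis. -/
theorem ae_exists_tendsto_boundary {f : ℂ → ℂ} {M : ℝ} (hf : DifferentiableOn ℂ f leftHalfPlane)
    (hM : ∀ s ∈ leftHalfPlane, ‖f s‖ ≤ M) :
    ∀ᵐ ξ : ℝ, ∃ c : ℂ, Tendsto
      (fun σ : ℝ => f ((σ : ℂ) + 2 * (Real.pi : ℂ) * Complex.I * (ξ : ℂ))) (𝓝[<] 0) (𝓝 c) := by
  obtain ⟨G₀, hG₀⟩ := exists_primitive_leftHalfPlane hf
  have hM0 : 0 ≤ M := (norm_nonneg _).trans (hM (-1) (by simp [leftHalfPlane]))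
  have hLip : LipschitzOnWith M.toNNReal G₀ leftHalfPlane :=
    convex_leftHalfPlane.lipschitzOnWith_of_nnnorm_hasDerivWithin_le
      (fun s hs => (hG₀ s hs).hasDerivWithinAt) (fun s hs => by
        rw [← NNReal.coe_le_coe, Real.coe_toNNReal _ hM0]; exact hM s hs)
  -- A primitive of a bounded function is Lipschitz, so it has a Lipschitz trace on the axis, which
  -- is differentiable almost everywhere. At such points the boundary limit of f is shown to exist.
  obtain ⟨G, hG, hGG⟩ := hLip.extend_finite_dimension
  have hGd : ∀ s ∈ leftHalfPlane, HasDerivAt G (f s) s := fun s hs => by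
    refine (hG₀ s hs).congr_of_eventuallyEq ?_
    filter_upwards [isOpen_leftHalfPlane.mem_nhds hs] with z hz using (hGG hz).symm
  generalize lipschitzExtensionConstant ℂ * M.toNNReal = K at hG
  have hline : LipschitzWith (K * 1) fun y : ℝ => G (y * Complex.I) := by
    refine hG.comp ?_
    refine LipschitzWith.of_dist_le_mul fun x y => ?_
    rw [dist_eq_norm, dist_eq_norm, ← sub_mul, ← Complex.ofReal_sub, norm_mul, Complex.norm_real]
    simp
  have hae := hline.ae_differentiableAt (μ := volume)
  have hscale : ∀ᵐ ξ : ℝ, DifferentiableAt ℝ (fun y : ℝ => G (y * Complex.I)) (2 * Real.pi * ξ) := by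
    have h0 : (2 * Real.pi) ≠ 0 := by positivity
    have hq : Measure.QuasiMeasurePreserving (fun ξ : ℝ => 2 * Real.pi * ξ) volume volume := by
      refine ⟨by fun_prop, ?_⟩
      rw [Real.map_volume_mul_left h0]
      exact Measure.smul_absolutelyContinuous
    exact hq.ae hae
  filter_upwards [hscale] with ξ hξ
  set y₀ : ℝ := 2 * Real.pi * ξ with hy₀
  set s₀ : ℂ := y₀ * Complex.I with hs₀
  -- Along the axis d/dy G(iy) should equal i times the boundary value of f, hence the factor -i.
  set c : ℂ := deriv (fun y : ℝ => G (y * Complex.I)) y₀ * (-Complex.I) with hc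
  refine ⟨c, ?_⟩
  set h : ℂ → ℂ := fun s => G (s₀ + s) - G s₀ - c * s with hh
  have hcont : Continuous h := by
    have := hG.continuous
    fun_prop
  have hderiv : ∀ s ∈ leftHalfPlane, HasDerivAt h (f (s₀ + s) - c) s := by
    intro s hs
    have h1 : s₀ + s ∈ leftHalfPlane := by
      show (s₀ + s).re < 0
      simpa [hs₀, leftHalfPlane] using hs
    have h2 := (hGd _ h1).comp_const_add s₀ s
    simpa only [mul_one] using! (h2.sub_const (G s₀)).sub ((hasDerivAt_id s).const_mul c)
  have hgrow : ∀ s, ‖h s‖ ≤ (K + ‖c‖) * ‖s‖ := by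
    intro s
    have := hG.dist_le_mul (s₀ + s) s₀
    rw [dist_eq_norm, dist_eq_norm, add_sub_cancel_left] at this
    calc ‖h s‖ ≤ ‖G (s₀ + s) - G s₀‖ + ‖c * s‖ := norm_sub_le _ _
      _ ≤ K * ‖s‖ + ‖c‖ * ‖s‖ := by rw [norm_mul]; gcongr
      _ = _ := by ring
  have hsmall : ∀ ε > 0, ∃ δ > 0, ∀ y : ℝ, |y| < δ → ‖h (y * Complex.I)‖ ≤ ε * |y| := by
    intro ε hε
    have h1 := (hasDerivAt_iff_isLittleO_nhds_zero.1 hξ.hasDerivAt).def hε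
    rw [Metric.eventually_nhds_iff] at h1
    obtain ⟨δ, hδ, h1⟩ := h1
    refine ⟨δ, hδ, fun y hy => ?_⟩
    have h2 := h1 (y := y) (by simpa using hy)
    rw [Real.norm_eq_abs] at h2
    have heq : h (y * Complex.I) = G (↑(y₀ + y) * Complex.I) - G (↑y₀ * Complex.I) -
        y • deriv (fun y : ℝ => G (y * Complex.I)) y₀ := by
      have hI := Complex.I_mul_I
      simp only [hh, hc, hs₀, Complex.real_smul]
      push_cast
      rw [add_mul]
      linear_combination (deriv (fun y : ℝ => G (y * Complex.I)) y₀ * y) * hI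
    rwa [heq]
  rw [tendsto_iff_norm_sub_tendsto_zero, Metric.tendsto_nhdsWithin_nhds]
  intro ε hε
  obtain ⟨ρ, hρ, hb⟩ := norm_le_mul_norm_near_zero_of_boundary hcont
    (fun s hs => (hderiv s hs).differentiableAt.differentiableWithinAt) hgrow hsmall
    (ε := ε / 4) (by positivity)
  refine ⟨ρ / 2, by positivity, fun σ hσ hσρ => ?_⟩
  have hσ : σ < 0 := hσ
  rw [Real.dist_eq, sub_zero, abs_of_neg hσ] at hσρ
  have hσmem : (σ : ℂ) ∈ leftHalfPlane := by simpa [leftHalfPlane] using hσ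
  have hball : ∀ z ∈ Metric.closedBall (σ : ℂ) (-σ / 2), z ∈ leftHalfPlane ∧ ‖z‖ ≤ 3 * (-σ / 2) := by
    intro z hz
    rw [Metric.mem_closedBall, dist_eq_norm] at hz
    constructor
    · have := (Complex.re_le_norm _).trans hz
      simp only [Complex.sub_re, Complex.ofReal_re] at this
      show z.re < 0
      linarith
    · have h1 := norm_le_norm_add_norm_sub' z σ
      rw [Complex.norm_real, Real.norm_of_nonpos hσ.le] at h1
      linarith
  -- Cauchy's estimate turns h = o(s) into h' = o(1). The disc of radius |σ|/2 about σ stays in the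
  -- half-plane and its points have modulus at most 3|σ|/2, so the bound for |f - c| is 3ε/4 < ε.
  have h1 := Complex.norm_deriv_le_of_forall_mem_sphere_norm_le (c := (σ : ℂ)) (R := -σ / 2)
    (C := ε / 4 * (3 * (-σ / 2))) (f := h) (by linarith) (by
      refine DifferentiableOn.diffContOnCl fun z hz => ?_
      rw [closure_ball _ (by linarith)] at hz
      exact (hderiv z (hball z hz).1).differentiableAt.differentiableWithinAt) (by
      intro z hz
      have h2 := hball z (Metric.sphere_subset_closedBall hz)
      refine (hb z h2.1 (by linarith [h2.2])).trans ?_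
      gcongr
      exact h2.2)
  rw [(hderiv _ hσmem).deriv] at h1
  rw [dist_zero_right, norm_norm]
  have h3 : (σ : ℂ) + 2 * (Real.pi : ℂ) * Complex.I * (ξ : ℂ) = s₀ + σ := by
    rw [hs₀, hy₀]; push_cast; ring
  rw [h3]
  refine h1.trans_lt ?_
  have h4 : ε / 4 * (3 * (-σ / 2)) / (-σ / 2) = 3 * ε / 4 := by
    have : σ ≠ 0 := hσ.ne
    field_simp
  rw [h4]; linarith

/-! ### Cauchy's theorem on the boundary of the left half-plane -/

/-- The point `2πiξ` of the imaginary axis. -/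
noncomputable def axisPoint (ξ : ℝ) : ℂ := 2 * (Real.pi : ℂ) * Complex.I * (ξ : ℂ)

@[simp] theorem axisPoint_re (ξ : ℝ) : (axisPoint ξ).re = 0 := by simp [axisPoint]

@[simp] theorem axisPoint_im (ξ : ℝ) : (axisPoint ξ).im = 2 * Real.pi * ξ := by simp [axisPoint]

@[fun_prop] theorem continuous_axisPoint : Continuous axisPoint := by
  unfold axisPoint; fun_prop

theorem conj_axisPoint (ξ : ℝ) : (starRingEnd ℂ) (axisPoint ξ) = -axisPoint ξ := by
  apply Complex.ext <;> simp

theorem axisPoint_eq_mul_I (ξ : ℝ) : axisPoint ξ = ((2 * Real.pi * ξ : ℝ) : ℂ) * Complex.I := by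
  apply Complex.ext <;> simp

theorem sub_ne_zero_of_re_pos {a s : ℂ} (ha : 0 < a.re) (hs : s.re ≤ 0) : a - s ≠ 0 := by
  intro h
  have : (a - s).re = 0 := by rw [h]; rfl
  rw [Complex.sub_re] at this
  linarith

theorem integrable_norm_inv_sq_real {N : ℝ} (hN : 0 < N) :
    Integrable fun y : ℝ => (N ^ 2 + y ^ 2)⁻¹ := by
  have h := (integrable_inv_one_add_sq.comp_mul_left' (inv_ne_zero hN.ne')).const_mul (N ^ 2)⁻¹
  refine h.congr (Eventually.of_forall fun y => ?_)
  simp only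
  field_simp

theorem integrable_norm_inv_sq {N : ℝ} (hN : 0 < N) :
    Integrable fun ξ : ℝ => (N ^ 2 + (2 * Real.pi * ξ) ^ 2)⁻¹ :=
  (integrable_norm_inv_sq_real hN).comp_mul_left' (by positivity)

theorem normSq_ofReal_sub_mul_I (N y : ℝ) {σ : ℝ} :
    ‖(N : ℂ) - (σ + y * Complex.I)‖ ^ 2 = (N - σ) ^ 2 + y ^ 2 := by
  rw [Complex.sq_norm, Complex.normSq_apply]
  simp
  ring

theorem norm_sub_axisPoint_sq (N ξ : ℝ) :
    ‖(N : ℂ) - axisPoint ξ‖ ^ 2 = N ^ 2 + (2 * Real.pi * ξ) ^ 2 := by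
  rw [Complex.sq_norm, Complex.normSq_apply]
  simp
  ring

section

variable {f : ℂ → ℂ} {M N : ℝ}

theorem norm_div_sq_le (hM : ∀ s ∈ leftHalfPlane, ‖f s‖ ≤ M) {s : ℂ} (hs : s ∈ leftHalfPlane)
    {r : ℝ} (hr : 0 < r) (hrs : r ≤ ‖(N : ℂ) - s‖ ^ 2) : ‖f s / (N - s) ^ 2‖ ≤ M * r⁻¹ := by
  rw [norm_div, norm_pow, div_eq_mul_inv]
  have hM0 : 0 ≤ M := (norm_nonneg _).trans (hM s hs)
  have := hM s hs
  gcongr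

/-- Cauchy's theorem on the rectangle with corners -R - iR and σ + iR. The kernel is at most R⁻² on
the other three sides, so the horizontal sides contribute M/R each and the left side 2M/R. -/
theorem norm_integral_vertical_segment_le (hf : DifferentiableOn ℂ f leftHalfPlane)
    (hM : ∀ s ∈ leftHalfPlane, ‖f s‖ ≤ M) (hN : 0 < N) {σ R : ℝ} (hσ : σ < 0) (hR : -σ < R) :
    ‖∫ y : ℝ in -R..R, f (σ + y * Complex.I) / (N - (σ + y * Complex.I)) ^ 2‖ ≤ 4 * M * R⁻¹ := by
  have hR0 : 0 < R := by linarith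
  have hM0 : 0 ≤ M := (norm_nonneg _).trans (hM (-1) (by simp [leftHalfPlane]))
  set F : ℂ → ℂ := fun s => f s / (N - s) ^ 2 with hF
  have hFd : DifferentiableOn ℂ F leftHalfPlane := by
    refine hf.div (by fun_prop) fun s hs => pow_ne_zero 2 ?_
    exact sub_ne_zero_of_re_pos (by simpa using hN) (le_of_lt hs)
  have hrect := Complex.integral_boundary_rect_eq_zero_of_differentiableOn F
    (⟨-R, -R⟩ : ℂ) (⟨σ, R⟩ : ℂ) (hFd.mono fun z hz => by
      have := (Complex.mem_reProdIm.1 hz).1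
      rw [Set.uIcc_of_le (by simpa using by linarith)] at this
      exact lt_of_le_of_lt this.2 hσ)
  simp only at hrect
  have hhor : ∀ y : ℝ, |y| = R → ‖∫ x : ℝ in -R..σ, F (x + y * Complex.I)‖ ≤ M * R⁻¹ := by
    intro y hy
    have h1 := intervalIntegral.norm_integral_le_of_norm_le_const (a := -R) (b := σ)
      (f := fun x : ℝ => F (x + y * Complex.I)) (C := M * (R ^ 2)⁻¹) (by
        intro x hx
        rw [Set.uIoc_of_le (by linarith)] at hx
        refine norm_div_sq_le hM ?_ (by positivity) ?_
        · have : x < 0 := lt_of_le_of_lt hx.2 hσ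
          simpa [leftHalfPlane] using this
        · rw [normSq_ofReal_sub_mul_I, ← hy, sq_abs]
          nlinarith [sq_nonneg (N - x)])
    refine h1.trans ?_
    rw [abs_of_nonneg (by linarith)]
    calc M * (R ^ 2)⁻¹ * (σ - -R) ≤ M * (R ^ 2)⁻¹ * R := by gcongr; linarith
      _ = M * R⁻¹ := by field_simp
  have hleft : ‖∫ y : ℝ in -R..R, F (((-R : ℝ) : ℂ) + y * Complex.I)‖ ≤ 2 * M * R⁻¹ := by
    have h1 := intervalIntegral.norm_integral_le_of_norm_le_const (a := -R) (b := R)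
      (f := fun y : ℝ => F (((-R : ℝ) : ℂ) + y * Complex.I)) (C := M * (R ^ 2)⁻¹) (by
        intro y hy
        refine norm_div_sq_le hM ?_ (by positivity) ?_
        · simpa [leftHalfPlane] using hR0
        · rw [normSq_ofReal_sub_mul_I]
          nlinarith [sq_nonneg y])
    refine h1.trans (le_of_eq ?_)
    rw [abs_of_nonneg (by linarith)]
    field_simp
    ring
  have hb := hhor (-R) (by rw [abs_neg, abs_of_pos hR0])
  have ht := hhor R (abs_of_pos hR0)
  set B := ∫ x : ℝ in -R..σ, F (x + ((-R : ℝ) : ℂ) * Complex.I)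
  set Tt := ∫ x : ℝ in -R..σ, F (x + (R : ℂ) * Complex.I)
  set Lf := ∫ y : ℝ in -R..R, F (((-R : ℝ) : ℂ) + y * Complex.I)
  set Rt := ∫ y : ℝ in -R..R, F ((σ : ℂ) + y * Complex.I)
  show ‖Rt‖ ≤ _
  have hsolve : Rt = Lf + Complex.I * B - Complex.I * Tt := by
    have h2 : B - Tt + Complex.I * Rt - Complex.I * Lf = 0 := by simpa [smul_eq_mul] using hrect
    have hI := Complex.I_mul_I
    linear_combination (-Complex.I) * h2 + (Rt - Lf) * hI
  rw [hsolve]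
  refine (norm_sub_le _ _).trans ?_
  rw [norm_mul, Complex.norm_I, one_mul]
  have h3 := norm_add_le Lf (Complex.I * B)
  rw [norm_mul, Complex.norm_I, one_mul] at h3
  linarith

theorem continuous_vertical_line (hf : DifferentiableOn ℂ f leftHalfPlane) {σ : ℝ} (hσ : σ < 0) :
    Continuous fun y : ℝ => f (σ + y * Complex.I) :=
  hf.continuousOn.comp_continuous (by fun_prop) fun y => by simpa [leftHalfPlane] using hσ

theorem integral_vertical_line_eq_zero (hf : DifferentiableOn ℂ f leftHalfPlane)
    (hM : ∀ s ∈ leftHalfPlane, ‖f s‖ ≤ M) (hN : 0 < N) {σ : ℝ} (hσ : σ < 0) :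
    ∫ y : ℝ, f (σ + y * Complex.I) / (N - (σ + y * Complex.I)) ^ 2 = 0 := by
  have hint : Integrable fun y : ℝ => f (σ + y * Complex.I) / (N - (σ + y * Complex.I)) ^ 2 := by
    refine ((integrable_norm_inv_sq_real hN).const_mul M).mono' ?_ (Eventually.of_forall fun y => ?_)
    · refine (Continuous.div (continuous_vertical_line hf hσ) (by fun_prop)
        fun y => pow_ne_zero 2 ?_).aestronglyMeasurable
      exact sub_ne_zero_of_re_pos (by simpa using hN) (by simpa using hσ.le)
    · refine norm_div_sq_le hM (by simpa [leftHalfPlane] using hσ) (by positivity) ?_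
      rw [normSq_ofReal_sub_mul_I]
      nlinarith
  have h1 := intervalIntegral_tendsto_integral hint tendsto_neg_atTop_atBot tendsto_id
  refine tendsto_nhds_unique h1 ?_
  refine squeeze_zero_norm' (a := fun R : ℝ => 4 * M * R⁻¹) ?_ ?_
  · filter_upwards [eventually_gt_atTop (-σ)] with R hR
    exact norm_integral_vertical_segment_le hf hM hN hσ hR
  · simpa using tendsto_inv_atTop_zero.const_mul (4 * M)

/-- `β` is the boundary function of `f` on the imaginary axis. -/
def HasBoundaryValues (f : ℂ → ℂ) (β : ℝ → ℂ) : Prop :=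
  ∀ᵐ ξ : ℝ, Tendsto (fun σ : ℝ => f (σ + axisPoint ξ)) (𝓝[<] 0) (𝓝 (β ξ))

/-- The vertical line integrals vanish for σ < 0. The kernel (N - s)⁻² supplies a dominating
function independent of σ, so the limit σ ↑ 0 may be taken under the integral without any
integrability of β. -/
theorem integral_boundary_div_sq_eq_zero {β : ℝ → ℂ} (hf : DifferentiableOn ℂ f leftHalfPlane)
    (hM : ∀ s ∈ leftHalfPlane, ‖f s‖ ≤ M) (hβ : HasBoundaryValues f β) (hN : 0 < N) :
    ∫ ξ : ℝ, β ξ / (N - axisPoint ξ) ^ 2 = 0 := by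
  have hσ : ∀ n : ℕ, -((n : ℝ) + 1)⁻¹ < 0 := fun n => by
    have : (0 : ℝ) < (n + 1 : ℝ)⁻¹ := by positivity
    linarith
  have hlim : Tendsto (fun n : ℕ => -((n : ℝ) + 1)⁻¹) atTop (𝓝[<] 0) := by
    refine tendsto_nhdsWithin_iff.2 ⟨?_, Eventually.of_forall hσ⟩
    have := (tendsto_one_div_add_atTop_nhds_zero_nat (𝕜 := ℝ)).neg
    simpa using this
  have hzero : ∀ n : ℕ, ∫ ξ : ℝ, f ((-((n : ℝ) + 1)⁻¹ : ℝ) + axisPoint ξ) /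
      (N - ((-((n : ℝ) + 1)⁻¹ : ℝ) + axisPoint ξ)) ^ 2 = 0 := by
    intro n
    have h1 := Measure.integral_comp_mul_left (fun y : ℝ => f ((-((n : ℝ) + 1)⁻¹ : ℝ) + y * Complex.I) /
      (N - ((-((n : ℝ) + 1)⁻¹ : ℝ) + y * Complex.I)) ^ 2) (2 * Real.pi)
    rw [integral_vertical_line_eq_zero hf hM hN (hσ n), smul_zero] at h1
    simpa only [← axisPoint_eq_mul_I] using h1
  have hdom := tendsto_integral_of_dominated_convergence (μ := volume)
    (F := fun (n : ℕ) (ξ : ℝ) => f ((-((n : ℝ) + 1)⁻¹ : ℝ) + axisPoint ξ) /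
      (N - ((-((n : ℝ) + 1)⁻¹ : ℝ) + axisPoint ξ)) ^ 2)
    (f := fun ξ => β ξ / (N - axisPoint ξ) ^ 2)
    (fun ξ => M * (N ^ 2 + (2 * Real.pi * ξ) ^ 2)⁻¹) ?_ ((integrable_norm_inv_sq hN).const_mul M)
    ?_ ?_
  · simp only [hzero] at hdom
    exact tendsto_nhds_unique tendsto_const_nhds hdom |>.symm
  · intro n
    simp only [axisPoint_eq_mul_I]
    have h2 : Continuous fun y : ℝ => f ((-((n : ℝ) + 1)⁻¹ : ℝ) + y * Complex.I) /
      (N - ((-((n : ℝ) + 1)⁻¹ : ℝ) + y * Complex.I)) ^ 2 := by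
      refine Continuous.div (continuous_vertical_line hf (hσ n)) (by fun_prop)
        fun y => pow_ne_zero 2 ?_
      exact sub_ne_zero_of_re_pos (by simpa using hN) (by
        rw [Complex.add_re, Complex.ofReal_re, Complex.re_ofReal_mul, Complex.I_re, mul_zero, add_zero]
        exact (hσ n).le)
    exact (h2.comp (continuous_const.mul continuous_id)).aestronglyMeasurable
  · refine fun n => Eventually.of_forall fun ξ => ?_
    refine norm_div_sq_le hM ?_ (by positivity) ?_
    · show (_ : ℂ).re < 0
      rw [Complex.add_re, axisPoint_re, Complex.ofReal_re, add_zero]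
      exact hσ n
    · rw [axisPoint_eq_mul_I, normSq_ofReal_sub_mul_I]
      nlinarith [hσ n]
  · filter_upwards [hβ] with ξ hξ
    refine (hξ.comp hlim).div ?_ (pow_ne_zero 2 (sub_ne_zero_of_re_pos (by simpa using hN) (by simp)))
    have h3 : Continuous fun σ : ℝ => ((N : ℂ) - ((σ : ℂ) + axisPoint ξ)) ^ 2 := by fun_prop
    have h4 := (h3.tendsto 0).comp (hlim.mono_right nhdsWithin_le_nhds)
    simpa [Function.comp_def] using h4

/-- A bounded analytic function on the left half-plane with integrable boundary values has
boundary integral zero. -/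
theorem integral_boundary_eq_zero {β : ℝ → ℂ} (hf : DifferentiableOn ℂ f leftHalfPlane)
    (hM : ∀ s ∈ leftHalfPlane, ‖f s‖ ≤ M) (hβ : HasBoundaryValues f β) (hint : Integrable β) :
    ∫ ξ : ℝ, β ξ = 0 := by
  -- With N = n + 1, the normalised kernel N²/(N - iω)² has modulus at most 1 and tends to 1
  -- pointwise, so it can be removed in the limit when β is integrable.
  have hdom := tendsto_integral_of_dominated_convergence (μ := volume)
    (F := fun (n : ℕ) (ξ : ℝ) => ((n : ℂ) + 1) ^ 2 * (β ξ / ((((n : ℝ) + 1 : ℝ) : ℂ) - axisPoint ξ) ^ 2))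
    (f := β) (fun ξ => ‖β ξ‖) ?_ hint.norm ?_ ?_
  · simp only [integral_const_mul,
      integral_boundary_div_sq_eq_zero hf hM hβ (by positivity : (0 : ℝ) < (_ : ℕ) + 1),
      mul_zero] at hdom
    exact tendsto_nhds_unique tendsto_const_nhds hdom |>.symm
  · intro n
    refine AEStronglyMeasurable.const_mul ?_ _
    refine hint.1.div₀ ?_
    exact Continuous.aestronglyMeasurable (by fun_prop)
  · refine fun n => Eventually.of_forall fun ξ => ?_
    rw [norm_mul, norm_div, norm_pow, norm_pow, norm_sub_axisPoint_sq]
    have : ‖(n : ℂ) + 1‖ = n + 1 := by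
      rw [← Nat.cast_one, ← Nat.cast_add, Complex.norm_natCast]; push_cast; ring
    rw [this, ← mul_div_assoc, div_le_iff₀ (by positivity), mul_comm]
    gcongr
    nlinarith [sq_nonneg (2 * Real.pi * ξ)]
  · refine Eventually.of_forall fun ξ => ?_
    have h1 : Tendsto (fun n : ℕ => ((n : ℂ) + 1)⁻¹) atTop (𝓝 0) := by
      simpa using tendsto_one_div_add_atTop_nhds_zero_nat (𝕜 := ℂ)
    have h2 : Tendsto (fun n : ℕ => β ξ / (1 - ((n : ℂ) + 1)⁻¹ * axisPoint ξ) ^ 2) atTop (𝓝 (β ξ)) := by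
      have h3 : ContinuousAt (fun z : ℂ => β ξ / (1 - z * axisPoint ξ) ^ 2) 0 := by
        refine ContinuousAt.div (by fun_prop) (by fun_prop) (by simp)
      simpa [Function.comp_def] using h3.tendsto.comp h1
    refine h2.congr fun n => ?_
    have h4 : (n : ℂ) + 1 ≠ 0 := by exact_mod_cast n.succ_ne_zero
    have h5 : (1 - ((n : ℂ) + 1)⁻¹ * axisPoint ξ) = ((n : ℂ) + 1)⁻¹ * ((n : ℂ) + 1 - axisPoint ξ) := by
      field_simp
    rw [h5, mul_pow]
    push_cast
    field_simp

end

/-! ### The Fourier transform of integrable and square integrable functions -/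

section

variable {X : Type*} [NormedAddCommGroup X] [InnerProductSpace ℂ X]

theorem continuous_fourier_real {f : ℝ → X} (h1 : Integrable f) : Continuous (𝓕 f) :=
  VectorFourier.fourierIntegral_continuous Real.continuous_fourierChar
    (by exact continuous_inner) h1

theorem fourier_eq_integral_exp (f : ℝ → X) (ξ : ℝ) :
    𝓕 f ξ = ∫ t : ℝ, Complex.exp (-axisPoint ξ * t) • f t := by
  rw [Real.fourier_real_eq_integral_exp_smul]
  refine integral_congr_ae (Eventually.of_forall fun t => ?_)
  simp only [axisPoint]
  congr 2
  push_cast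
  ring

theorem norm_cexp_neg_mul (a : ℂ) (t : ℝ) : ‖Complex.exp (-a * t)‖ = Real.exp (-a.re * t) := by
  rw [Complex.norm_exp]; simp

theorem memLp_exp_indicator {a : ℂ} (ha : 0 < a.re) :
    MemLp ((Set.Ioi (0 : ℝ)).indicator fun t : ℝ => Complex.exp (-a * t)) 2 (volume : Measure ℝ) := by
  rw [memLp_indicator_iff_restrict measurableSet_Ioi,
    memLp_two_iff_integrable_sq_norm (Continuous.aestronglyMeasurable (by fun_prop))]
  have h2 : IntegrableOn (fun t : ℝ => Real.exp (-(2 * a.re) * t)) (Set.Ioi 0) :=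
    exp_neg_integrableOn_Ioi 0 (by positivity)
  refine h2.congr (Eventually.of_forall fun t => ?_)
  simp only [norm_cexp_neg_mul, ← Real.exp_nat_mul]
  congr 1
  push_cast
  ring

theorem integrable_exp_indicator_smul {a : ℂ} (ha : 0 < a.re) {f : ℝ → X}
    (hf : MemLp f 2 (volume : Measure ℝ)) :
    Integrable ((Set.Ioi (0 : ℝ)).indicator fun t : ℝ => Complex.exp (-a * t) • f t) := by
  have := (hf.smul (r := 1) (memLp_exp_indicator ha))
  rw [memLp_one_iff_integrable] at this
  refine this.congr (Eventually.of_forall fun t => ?_)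
  by_cases ht : 0 < t <;> simp [ht]

theorem memLp_exp_indicator_smul {a : ℂ} (ha : 0 < a.re) {f : ℝ → X}
    (hf : MemLp f 2 (volume : Measure ℝ)) :
    MemLp ((Set.Ioi (0 : ℝ)).indicator fun t : ℝ => Complex.exp (-a * t) • f t) 2
      (volume : Measure ℝ) := by
  refine hf.mono ?_ (Eventually.of_forall fun t => ?_)
  · refine AEStronglyMeasurable.indicator ?_ measurableSet_Ioi
    exact AEStronglyMeasurable.smul (Continuous.aestronglyMeasurable (by fun_prop)) hf.1
  · by_cases ht : 0 < t
    · rw [Set.indicator_of_mem (Set.mem_Ioi.2 ht), norm_smul, norm_cexp_neg_mul]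
      refine mul_le_of_le_one_left (norm_nonneg _) (Real.exp_le_one_iff.2 ?_)
      nlinarith
    · rw [Set.indicator_of_notMem (by simpa using ht), norm_zero]
      exact norm_nonneg _

theorem mem_L2Pos_iff (f : Lp X 2 (volume : Measure ℝ)) :
    f ∈ L2Pos X ↔ ∀ᵐ t : ℝ, t ≤ 0 → f t = 0 := by
  rw [L2Pos, LinearMap.mem_ker]
  have h := LpToLpRestrictCLM_coeFn (μ := (volume : Measure ℝ)) ℂ (Set.Iic 0) f
  constructor
  · intro h0
    have h1 : (LpToLpRestrictCLM ℝ X ℂ volume 2 (Set.Iic 0)) f = 0 := h0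
    rw [h1] at h
    have h2 := h.symm.trans (Lp.coeFn_zero X 2 _)
    exact (ae_restrict_iff' measurableSet_Iic).1 h2
  · intro h0
    refine (Lp.eq_zero_iff_ae_eq_zero (f := LpToLpRestrictCLM ℝ X ℂ volume 2 (Set.Iic 0) f)).2 ?_
    refine h.trans ?_
    exact (ae_restrict_iff' measurableSet_Iic).2 h0

variable [CompleteSpace X]

open SchwartzMap in
/-- The `L²` Fourier transform of an integrable function is given by the Fourier integral. -/
theorem fourier_toLp_ae_eq {f : ℝ → X} (h1 : Integrable f) (h2 : MemLp f 2 (volume : Measure ℝ)) :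
    (𝓕 (h2.toLp f) : Lp X 2 (volume : Measure ℝ)) =ᵐ[volume] 𝓕 f := by
  refine ae_eq_of_integral_contDiff_smul_eq
    ((Lp.memLp _).locallyIntegrable one_le_two)
    (continuous_fourier_real h1).locallyIntegrable fun g hg hgc => ?_
  have hg₁ : HasCompactSupport (Complex.ofRealCLM ∘ g) := hgc.comp_left rfl
  have hg₂ : ContDiff ℝ ((⊤ : ℕ∞) : WithTop ℕ∞) (Complex.ofRealCLM ∘ g) := by fun_prop
  set φ : 𝓢(ℝ, ℂ) := hg₁.toSchwartzMap hg₂ with hφ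
  have hφg : ∀ x, φ x = (g x : ℂ) := fun x => rfl
  have e1 : ∫ x, g x • (𝓕 (h2.toLp f) : Lp X 2 (volume : Measure ℝ)) x =
      Lp.toTemperedDistribution (𝓕 (h2.toLp f) : Lp X 2 (volume : Measure ℝ)) φ := by
    rw [Lp.toTemperedDistribution_apply]
    simp only [hφg, Complex.coe_smul]
  -- Both sides are compared as tempered distributions: the transform moves onto the test function
  -- on the L² side, and Fubini moves it back onto the integrable function.
  rw [e1, ← Lp.fourier_toTemperedDistribution_eq, TemperedDistribution.fourier_apply,
    Lp.toTemperedDistribution_apply]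
  have e2 : ∫ x, (𝓕 φ) x • (h2.toLp f) x = ∫ x, (𝓕 φ) x • f x := by
    refine integral_congr_ae ?_
    filter_upwards [h2.coeFn_toLp] with x hx
    rw [hx]
  rw [e2]
  have e3 := VectorFourier.integral_fourierIntegral_smul_eq_flip (μ := volume) (ν := volume)
    (L := innerₗ ℝ) (f := φ) (g := f) Real.continuous_fourierChar (by exact continuous_inner)
    φ.integrable h1
  rw [flip_innerₗ] at e3
  rw [fourier_coe]
  refine e3.trans ?_
  simp only [hφg, Complex.coe_smul]
  rfl

/-- The Laplace transform is injective on `L²((0, ∞); X)`. -/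
theorem ae_eq_zero_of_laplace_eq_zero {f : ℝ → X} (hf : MemLp f 2 (volume : Measure ℝ))
    (h : ∀ a : ℂ, 0 < a.re → ∫ t in Set.Ioi (0 : ℝ), Complex.exp (-a * t) • f t = 0) :
    ∀ᵐ t : ℝ, 0 < t → f t = 0 := by
  -- The weight e^{-t} puts f on (0, ∞) in L¹ ∩ L². Its Fourier transform is then the Laplace
  -- transform on the line Re a = 1, and Plancherel gives injectivity.
  have h1 := integrable_exp_indicator_smul (a := 1) (by simp) hf
  have h2 := memLp_exp_indicator_smul (a := 1) (by simp) hf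
  have hF := fourier_toLp_ae_eq h1 h2
  have hzero : ∀ ξ, 𝓕 ((Set.Ioi (0 : ℝ)).indicator fun t : ℝ => Complex.exp (-1 * t) • f t) ξ = 0 := by
    intro ξ
    rw [fourier_eq_integral_exp, ← h (1 + axisPoint ξ) (by simp), ← integral_indicator measurableSet_Ioi]
    refine integral_congr_ae (Eventually.of_forall fun t => ?_)
    by_cases ht : 0 < t
    · simp only [Set.indicator_of_mem (Set.mem_Ioi.2 ht), smul_smul, ← Complex.exp_add]
      congr 2
      ring
    · simp [ht]
  have h3 : (𝓕 (h2.toLp _) : Lp X 2 (volume : Measure ℝ)) = 0 := by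
    rw [Lp.eq_zero_iff_ae_eq_zero]
    filter_upwards [hF] with ξ hξ
    rw [hξ, hzero]; rfl
  have h4 : h2.toLp _ = 0 := (Lp.fourierTransformₗᵢ ℝ X).map_eq_zero_iff.1 h3
  rw [Lp.eq_zero_iff_ae_eq_zero] at h4
  filter_upwards [h4, h2.coeFn_toLp] with t ht1 ht2 ht
  rw [ht1, Set.indicator_of_mem (Set.mem_Ioi.2 ht)] at ht2
  exact (smul_eq_zero.1 ht2.symm).resolve_left (Complex.exp_ne_zero _)

/-! ### The Hardy space and the Toeplitz operator under the Fourier transform. -/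

theorem fourier_mem_H2 {f : Lp X 2 (volume : Measure ℝ)} (hf : f ∈ L2Pos X) :
    (𝓕 f : Lp X 2 (volume : Measure ℝ)) ∈ H2 X :=
  Submodule.mem_map_of_mem hf

theorem fourierInv_mem_L2Pos {q : Lp X 2 (volume : Measure ℝ)} (hq : q ∈ H2 X) :
    (𝓕⁻ q : Lp X 2 (volume : Measure ℝ)) ∈ L2Pos X := by
  obtain ⟨f, hf, rfl⟩ := hq
  have : (𝓕⁻ (𝓕 f : Lp X 2 (volume : Measure ℝ)) : Lp X 2 (volume : Measure ℝ)) = f :=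
    FourierTransform.fourierInv_fourier_eq f
  show (𝓕⁻ (𝓕 f : Lp X 2 (volume : Measure ℝ)) : Lp X 2 (volume : Measure ℝ)) ∈ L2Pos X
  rw [this]
  exact hf

theorem fourier_toeplitz (b : Lp ℂ ∞ (volume : Measure ℝ)) (f : Lp X 2 (volume : Measure ℝ)) :
    (𝓕 (toeplitz b f) : Lp X 2 (volume : Measure ℝ)) =
      (H2 X).starProjection (b • (𝓕 f : Lp X 2 (volume : Measure ℝ)) : Lp X 2 (volume : Measure ℝ)) :=
  FourierTransform.fourier_fourierInv_eq _

/-- Tested against functions supported on (0, ∞), the projection Π disappears: it is self-adjoint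
and fixes their Fourier transforms. -/
theorem inner_toeplitz (b : Lp ℂ ∞ (volume : Measure ℝ)) (f : Lp X 2 (volume : Measure ℝ))
    {e : Lp X 2 (volume : Measure ℝ)} (he : e ∈ L2Pos X) :
    inner ℂ e (toeplitz b f) = inner ℂ (𝓕 e : Lp X 2 (volume : Measure ℝ))
      (b • (𝓕 f : Lp X 2 (volume : Measure ℝ)) : Lp X 2 (volume : Measure ℝ)) := by
  rw [← Lp.inner_fourier_eq, fourier_toeplitz, ← Submodule.inner_starProjection_left_eq_right,
    Submodule.starProjection_eq_self_iff.2 (fourier_mem_H2 he)]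

end

/-! ### The resolvent of the generator of an exponentially stable semigroup -/

theorem setIntegral_Ioi_comp_add_right {E : Type*} [NormedAddCommGroup E] [NormedSpace ℝ E]
    (g : ℝ → E) (h : ℝ) : ∫ t in Set.Ioi 0, g (t + h) = ∫ t in Set.Ioi h, g t := by
  rw [← integral_indicator measurableSet_Ioi, ← integral_indicator measurableSet_Ioi,
    ← integral_add_right_eq_self ((Set.Ioi h).indicator g) h]
  refine integral_congr_ae (Eventually.of_forall fun t => ?_)
  by_cases ht : 0 < t
  · simp [ht]
  · simp [ht]

theorem tendsto_coe_nnreal_nhdsGT_zero : Tendsto ((↑) : ℝ≥0 → ℝ) (𝓝[>] 0) (𝓝[>] 0) := by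
  refine tendsto_nhdsWithin_iff.2 ⟨?_, ?_⟩
  · exact (NNReal.continuous_coe.tendsto 0).mono_left nhdsWithin_le_nhds
  · filter_upwards [self_mem_nhdsWithin] with t ht
    exact NNReal.coe_pos.2 ht

namespace C0Semigroup

variable {X : Type*} [NormedAddCommGroup X] [InnerProductSpace ℂ X]

theorem continuous_op_toNNReal (T : C0Semigroup X) (x : X) :
    Continuous fun t : ℝ => T.op t.toNNReal x :=
  (T.continuous_orbit x).comp continuous_real_toNNReal

theorem op_comm (T : C0Semigroup X) (s t : ℝ≥0) (x : X) : T.op s (T.op t x) = T.op t (T.op s x) := by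
  rw [← ContinuousLinearMap.comp_apply, ← T.op_add, add_comm, T.op_add, ContinuousLinearMap.comp_apply]

/-- The integrand of the Laplace transform of an orbit. -/
noncomputable def laplaceIntegrand (T : C0Semigroup X) (a : ℂ) (x : X) (t : ℝ) : X :=
  Complex.exp (-a * t) • T.op t.toNNReal x

theorem continuous_laplaceIntegrand (T : C0Semigroup X) (a : ℂ) (x : X) :
    Continuous (T.laplaceIntegrand a x) :=
  Continuous.smul (by fun_prop) (T.continuous_op_toNNReal x)

theorem laplaceIntegrand_zero (T : C0Semigroup X) (a : ℂ) (x : X) :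
    T.laplaceIntegrand a x 0 = x := by
  simp [laplaceIntegrand, T.op_zero]

theorem laplaceIntegrand_add (T : C0Semigroup X) (a : ℂ) (x : X) {t : ℝ} (ht : 0 < t) (h : ℝ≥0) :
    T.op h (T.laplaceIntegrand a x t) = Complex.exp (a * (h : ℝ)) • T.laplaceIntegrand a x (t + h) := by
  have h1 : (t + h).toNNReal = h + t.toNNReal := by
    rw [Real.toNNReal_add ht.le h.coe_nonneg, Real.toNNReal_coe, add_comm]
  simp only [laplaceIntegrand, map_smul, h1, T.op_add, ContinuousLinearMap.comp_apply, smul_smul,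
    ← Complex.exp_add]
  congr 2
  push_cast
  ring

namespace IsExponentiallyStable

variable {T : C0Semigroup X} (hT : T.IsExponentiallyStable)

include hT in
theorem exists_bound : ∃ g : ℝ → ℝ, IntegrableOn g (Set.Ioi 0) ∧
    ∀ (a : ℂ) (x : X) (t : ℝ), 0 ≤ a.re → 0 < t → ‖T.laplaceIntegrand a x t‖ ≤ g t * ‖x‖ := by
  obtain ⟨M, ω, hω, hM⟩ := hT
  refine ⟨fun t => M * Real.exp (-ω * t), (exp_neg_integrableOn_Ioi 0 hω).const_mul M,
    fun a x t ha ht => ?_⟩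
  have h1 := (T.op t.toNNReal).le_of_opNorm_le (hM t.toNNReal) x
  rw [Real.coe_toNNReal t ht.le] at h1
  rw [laplaceIntegrand, norm_smul, norm_cexp_neg_mul]
  refine le_trans (mul_le_of_le_one_left (norm_nonneg _) (Real.exp_le_one_iff.2 ?_)) h1
  nlinarith

include hT in
theorem integrableOn_laplaceIntegrand {a : ℂ} (ha : 0 ≤ a.re) (x : X) :
    IntegrableOn (T.laplaceIntegrand a x) (Set.Ioi 0) := by
  obtain ⟨g, hg, hb⟩ := hT.exists_bound
  refine (hg.mul_const ‖x‖).mono' (T.continuous_laplaceIntegrand a x).aestronglyMeasurable ?_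
  filter_upwards [ae_restrict_mem measurableSet_Ioi] with t ht using hb a x t ha ht

include hT in
theorem exists_norm_integral_le : ∃ C : ℝ, 0 ≤ C ∧ ∀ (a : ℂ) (x : X), 0 ≤ a.re →
    ‖∫ t in Set.Ioi 0, T.laplaceIntegrand a x t‖ ≤ C * ‖x‖ := by
  obtain ⟨g, hg, hb⟩ := hT.exists_bound
  refine ⟨|∫ t in Set.Ioi 0, g t|, abs_nonneg _, fun a x ha => ?_⟩
  refine (norm_integral_le_of_norm_le (hg.mul_const ‖x‖) ?_).trans ?_
  · filter_upwards [ae_restrict_mem measurableSet_Ioi] with t ht using hb a x t ha ht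
  · rw [integral_mul_const]
    gcongr
    exact le_abs_self _

open Classical in
/-- The Laplace transform `∫ e^{-at} T(t) dt` of the semigroup, for `0 ≤ Re a`; this is the
resolvent `(a - A)⁻¹` of the generator. -/
noncomputable def res (hT : T.IsExponentiallyStable) (a : ℂ) : X →L[ℂ] X :=
  if ha : 0 ≤ a.re then
    LinearMap.mkContinuousOfExistsBound
      { toFun := fun x => ∫ t in Set.Ioi 0, T.laplaceIntegrand a x t
        map_add' := fun x y => by
          rw [← integral_add (hT.integrableOn_laplaceIntegrand ha x)
            (hT.integrableOn_laplaceIntegrand ha y)]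
          simp [laplaceIntegrand]
        map_smul' := fun c x => by
          rw [RingHom.id_apply, ← integral_smul]
          simp [laplaceIntegrand, smul_comm c] }
      (hT.exists_norm_integral_le.imp fun _ hC x => hC.2 a x ha)
  else 0

theorem res_apply {a : ℂ} (ha : 0 ≤ a.re) (x : X) :
    hT.res a x = ∫ t in Set.Ioi 0, T.laplaceIntegrand a x t := by
  rw [res, dif_pos ha]; rfl

theorem exists_norm_res_le : ∃ C : ℝ, 0 ≤ C ∧ ∀ a : ℂ, ‖hT.res a‖ ≤ C := by
  obtain ⟨C, hC, h⟩ := hT.exists_norm_integral_le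
  refine ⟨C, hC, fun a => ?_⟩
  by_cases ha : 0 ≤ a.re
  · exact ContinuousLinearMap.opNorm_le_bound _ hC fun x => by
      rw [hT.res_apply ha]; exact h a x ha
  · rw [res, dif_neg ha, norm_zero]; exact hC

variable [CompleteSpace X]

theorem map_res_apply {Y : Type*} [NormedAddCommGroup Y] [NormedSpace ℂ Y] [CompleteSpace Y]
    (L : X →L[ℂ] Y) {a : ℂ} (ha : 0 ≤ a.re) (x : X) :
    L (hT.res a x) = ∫ t in Set.Ioi 0, L (T.laplaceIntegrand a x t) := by
  rw [hT.res_apply ha]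
  exact (L.integral_comp_comm (hT.integrableOn_laplaceIntegrand ha x)).symm

/-- Applying T(h) translates the orbit under the integral, which loses the piece over (0, h) and
gains the factor e^{ah}. Differentiating at h = 0 then gives A R(a)x = a R(a)x - x. -/
theorem op_res_apply {a : ℂ} (ha : 0 ≤ a.re) (h : ℝ≥0) (x : X) :
    T.op h (hT.res a x) = Complex.exp (a * (h : ℝ)) •
      (hT.res a x - ∫ s in (0 : ℝ)..h, T.laplaceIntegrand a x s) := by
  rw [hT.map_res_apply _ ha, hT.res_apply ha,
    ← intervalIntegral.integral_Ioi_sub_Ioi (hT.integrableOn_laplaceIntegrand ha x) h.coe_nonneg,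
    sub_sub_cancel, ← setIntegral_Ioi_comp_add_right (T.laplaceIntegrand a x), ← integral_smul]
  exact setIntegral_congr_fun measurableSet_Ioi fun t ht => T.laplaceIntegrand_add a x (Set.mem_Ioi.1 ht) h

theorem res_op_apply {a : ℂ} (ha : 0 ≤ a.re) (h : ℝ≥0) (x : X) :
    hT.res a (T.op h x) = T.op h (hT.res a x) := by
  rw [hT.map_res_apply _ ha, hT.res_apply ha]
  refine setIntegral_congr_fun measurableSet_Ioi fun t _ => ?_
  simp [laplaceIntegrand, T.op_comm]

theorem hasDerivAt_integral_laplaceIntegrand (T : C0Semigroup X) (a : ℂ) (x : X) :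
    HasDerivAt (fun h : ℝ => ∫ s in (0 : ℝ)..h, T.laplaceIntegrand a x s) x 0 := by
  have := (T.continuous_laplaceIntegrand a x).integral_hasStrictDerivAt 0 0
  rw [T.laplaceIntegrand_zero] at this
  exact this.hasDerivAt

theorem tendsto_difference_quotient_res {a : ℂ} (ha : 0 ≤ a.re) (x : X) :
    Tendsto (fun t : ℝ≥0 => ((t : ℝ) : ℂ)⁻¹ • (T.op t (hT.res a x) - hT.res a x)) (𝓝[>] 0)
      (𝓝 (a • hT.res a x - x)) := by
  have hexp : HasDerivAt (fun h : ℝ => Complex.exp (a * h)) a 0 := by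
    have h1 : HasDerivAt (fun h : ℝ => a * (h : ℂ)) a 0 := by
      simpa using (Complex.ofRealCLM.hasDerivAt (x := 0)).const_mul a
    simpa using h1.cexp
  have hd := hexp.smul ((hasDerivAt_integral_laplaceIntegrand T a x).const_sub (hT.res a x))
  have hslope := hd.tendsto_slope_zero_right.comp tendsto_coe_nnreal_nhdsGT_zero
  simp only [intervalIntegral.integral_same, sub_zero, Complex.ofReal_zero, mul_zero,
    Complex.exp_zero, one_smul, smul_neg, neg_add_eq_sub] at hslope
  refine hslope.congr fun t => ?_
  rw [hT.op_res_apply ha, ← Complex.ofReal_inv, Complex.coe_smul]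
  simp

/-! ### The Laplace transform of the semigroup as the resolvent of its generator. -/

section Generator

variable {A : X →ₗ.[ℂ] X} (hA : T.IsGenerator A)

include hA

theorem res_mem_graph {a : ℂ} (ha : 0 ≤ a.re) (x : X) :
    (hT.res a x, a • hT.res a x - x) ∈ A.graph :=
  (hA _ _).2 (hT.tendsto_difference_quotient_res ha x)

/-- R(a) commutes with the semigroup and is continuous, so R(a)y is the limit of the difference
quotients of R(a)x, which is already known. -/
theorem res_apply_of_mem_graph {a : ℂ} (ha : 0 ≤ a.re) {x y : X} (h : (x, y) ∈ A.graph) :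
    hT.res a (a • x - y) = x := by
  have h1 := ((hT.res a).continuous.tendsto _).comp ((hA x y).1 h)
  have h2 := hT.tendsto_difference_quotient_res ha x
  have h3 : hT.res a y = a • hT.res a x - x := by
    refine tendsto_nhds_unique h1 (h2.congr fun t => ?_)
    simp only [Function.comp_apply, map_smul, map_sub, hT.res_op_apply ha]
  rw [map_sub, map_smul, h3, sub_sub_cancel]

omit [CompleteSpace X] in
theorem op_mem_graph (h : ℝ≥0) {x y : X} (hxy : (x, y) ∈ A.graph) :
    (T.op h x, T.op h y) ∈ A.graph := by
  refine (hA _ _).2 ((((T.op h).continuous.tendsto _).comp ((hA x y).1 hxy)).congr fun t => ?_)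
  simp only [Function.comp_apply, map_smul, map_sub, T.op_comm h]

/-- The resolvent identity: R(a) is applied to (a - A)R(b)x = (a - b)R(b)x + x. -/
theorem res_sub_res {a b : ℂ} (ha : 0 ≤ a.re) (hb : 0 ≤ b.re) (x : X) :
    hT.res b x - hT.res a x = (a - b) • hT.res a (hT.res b x) := by
  have h1 := hT.res_apply_of_mem_graph hA ha (hT.res_mem_graph hA hb x)
  have h2 : a • hT.res b x - (b • hT.res b x - x) = (a - b) • hT.res b x + x := by
    rw [sub_smul]; abel
  rw [h2, map_add, map_smul] at h1
  rw [sub_eq_iff_eq_add, h1]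

/-- Exponential stability bounds the resolvent uniformly on the closed right half-plane, so the
resolvent identity makes it Lipschitz there, the imaginary axis included. -/
theorem continuousOn_res : ContinuousOn hT.res {a : ℂ | 0 ≤ a.re} := by
  obtain ⟨C, hC0, hC⟩ := hT.exists_norm_res_le
  refine LipschitzOnWith.continuousOn (K := (C * C).toNNReal)
    (LipschitzOnWith.of_dist_le_mul fun b hb a ha => ?_)
  rw [Real.coe_toNNReal _ (by positivity), dist_eq_norm, dist_eq_norm]
  refine ContinuousLinearMap.opNorm_le_bound _ (by positivity) fun x => ?_
  rw [sub_apply, hT.res_sub_res hA ha hb, norm_smul, norm_sub_rev]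
  have h1 := (hT.res a).le_of_opNorm_le (hC a) (hT.res b x)
  have h2 := (hT.res b).le_of_opNorm_le (hC b) x
  calc _ ≤ ‖b - a‖ * (C * (C * ‖x‖)) := by gcongr; exact h1.trans (by gcongr)
    _ = _ := by ring

theorem differentiableAt_res_apply {a : ℂ} (ha : 0 < a.re) (x : X) :
    DifferentiableAt ℂ (fun b => hT.res b x) a := by
  have hmem : {b : ℂ | 0 ≤ b.re} ∈ 𝓝 a := by
    filter_upwards [(isOpen_lt continuous_const Complex.continuous_re).mem_nhds ha] with b hb
    exact le_of_lt hb
  have hc : ContinuousAt (fun b => hT.res b x) a :=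
    ((hT.continuousOn_res hA).continuousAt hmem).clm_apply continuousAt_const
  refine HasDerivAt.differentiableAt (f' := -hT.res a (hT.res a x)) ?_
  rw [hasDerivAt_iff_tendsto_slope]
  have h1 : Tendsto (fun b => -hT.res a (hT.res b x)) (𝓝[≠] a) (𝓝 (-hT.res a (hT.res a x))) :=
    ((((hT.res a).continuous.tendsto _).comp hc.tendsto).neg).mono_left nhdsWithin_le_nhds
  refine h1.congr' ?_
  filter_upwards [self_mem_nhdsWithin, nhdsWithin_le_nhds hmem] with b hb hb'
  rw [slope_def_module, hT.res_sub_res hA ha.le hb', smul_smul, ← neg_sub b a, mul_neg,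
    inv_mul_cancel₀ (sub_ne_zero.2 hb), neg_one_smul]

omit hA in
/-- The range of the resolvent is dense, in the form of an extensionality principle. -/
theorem clm_ext_of_comp_res {Y : Type*} [NormedAddCommGroup Y] [NormedSpace ℂ Y]
    {L L' : X →L[ℂ] Y} {a : ℂ} (ha : 0 ≤ a.re)
    (h : ∀ x, L (hT.res a x) = L' (hT.res a x)) : L = L' := by
  ext x
  have hI : ∀ t : ℝ, 0 < t → L (∫ s in (0 : ℝ)..t, T.laplaceIntegrand a x s) =
      L' (∫ s in (0 : ℝ)..t, T.laplaceIntegrand a x s) := by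
    intro t ht
    have h1 := hT.op_res_apply ha t.toNNReal x
    rw [Real.coe_toNNReal t ht.le] at h1
    -- Integrals of the orbit over (0, t) lie in the range of R(a), and divided by t they converge
    -- to x.
    have h2 : ∫ s in (0 : ℝ)..t, T.laplaceIntegrand a x s =
        hT.res a (x - Complex.exp (-(a * t)) • T.op t.toNNReal x) := by
      rw [map_sub, map_smul, hT.res_op_apply ha, h1, smul_smul, ← Complex.exp_add,
        neg_add_cancel, Complex.exp_zero, one_smul, sub_sub_cancel]
    rw [h2, h]
  have hd := (hasDerivAt_integral_laplaceIntegrand T a x).tendsto_slope_zero_right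
  have h1 := ((L.continuous.tendsto _).comp hd)
  have h2 := ((L'.continuous.tendsto _).comp hd)
  refine tendsto_nhds_unique h1 (h2.congr' ?_)
  filter_upwards [self_mem_nhdsWithin] with t ht
  simp only [Function.comp_apply, zero_add, intervalIntegral.integral_same, sub_zero,
    ← Complex.coe_smul, map_smul, hI t ht]

/-! ### The conjugate resolvent as an analytic function on the left half-plane -/

/-- Reflection in the axis sends s to -s̄ in the right half-plane, and the conjugate linearity of
the first slot of the inner product undoes the conjugation. On the axis itself -s̄ = s. -/
theorem differentiableOn_inner_res (y x : X) :
    DifferentiableOn ℂ (fun s : ℂ => inner ℂ (hT.res (-(starRingEnd ℂ) s) y) x) leftHalfPlane := by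
  intro s hs
  have hs : s.re < 0 := hs
  have h1 : DifferentiableAt ℂ (fun b : ℂ => inner ℂ x (hT.res (-b) y)) ((starRingEnd ℂ) s) := by
    have h2 : DifferentiableAt ℂ (fun b : ℂ => hT.res (-b) y) ((starRingEnd ℂ) s) :=
      DifferentiableAt.comp (g := fun b => hT.res b y) _
        (hT.differentiableAt_res_apply hA (by simpa using hs) y) differentiableAt_id.neg
    exact (innerSL ℂ x).differentiableAt.comp _ h2
  have h3 := h1.conj_conj
  rw [Complex.conj_conj] at h3
  refine (h3.congr_of_eventuallyEq (Eventually.of_forall fun z => ?_)).differentiableWithinAt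
  simp

theorem hasBoundaryValues_inner_res (y x : X) :
    HasBoundaryValues (fun s : ℂ => inner ℂ (hT.res (-(starRingEnd ℂ) s) y) x)
      (fun ξ => inner ℂ (hT.res (axisPoint ξ) y) x) := by
  refine Eventually.of_forall fun ξ => ?_
  have hc := (hT.continuousOn_res hA).continuousWithinAt (x := axisPoint ξ)
    (show 0 ≤ (axisPoint ξ).re by simp)
  have hlim : Tendsto (fun σ : ℝ => -(starRingEnd ℂ) ((σ : ℂ) + axisPoint ξ)) (𝓝[<] 0)
      (𝓝[{a : ℂ | 0 ≤ a.re}] axisPoint ξ) := by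
    refine tendsto_nhdsWithin_iff.2 ⟨?_, ?_⟩
    · have : Continuous fun σ : ℝ => -(starRingEnd ℂ) ((σ : ℂ) + axisPoint ξ) := by fun_prop
      have h1 := (this.tendsto 0).mono_left (nhdsWithin_le_nhds (s := Set.Iio 0))
      simpa [conj_axisPoint] using h1
    · filter_upwards [self_mem_nhdsWithin] with σ hσ
      have : σ < 0 := hσ
      simpa using this.le
  have h2 := hc.tendsto.comp hlim
  exact (((ContinuousLinearMap.apply ℂ X y).continuous.tendsto _).comp h2).inner tendsto_const_nhds

omit [CompleteSpace X] hA in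
theorem exists_norm_inner_res_le (y x : X) :
    ∃ C : ℝ, ∀ s : ℂ, ‖(inner ℂ (hT.res (-(starRingEnd ℂ) s) y) x : ℂ)‖ ≤ C := by
  obtain ⟨C, hC0, hC⟩ := hT.exists_norm_res_le
  refine ⟨C * ‖y‖ * ‖x‖, fun s => (norm_inner_le_norm _ _).trans ?_⟩
  gcongr
  exact (hT.res _).le_of_opNorm_le (hC _) y

end Generator

/-! ### The Fourier transform of an orbit -/

omit [CompleteSpace X] in
include hT in
theorem integrable_orbit (x : X) : Integrable (T.orbit x) := by
  rw [orbit, integrable_indicator_iff measurableSet_Ioi]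
  refine (hT.integrableOn_laplaceIntegrand (a := 0) (by simp) x).congr
    (Eventually.of_forall fun t => ?_)
  simp [laplaceIntegrand]

omit [CompleteSpace X] in
theorem fourier_orbit (x : X) (ξ : ℝ) : 𝓕 (T.orbit x) ξ = hT.res (axisPoint ξ) x := by
  rw [fourier_eq_integral_exp, hT.res_apply (by simp), ← integral_indicator measurableSet_Ioi]
  refine integral_congr_ae (Eventually.of_forall fun t => ?_)
  by_cases ht : 0 < t <;> simp [orbit, laplaceIntegrand, ht]

theorem fourier_orbitL2 (x : X) :
    (𝓕 (T.orbitL2 hT x) : Lp X 2 (volume : Measure ℝ)) =ᵐ[volume] fun ξ => hT.res (axisPoint ξ) x := by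
  refine (fourier_toLp_ae_eq (hT.integrable_orbit x) (hT.memLp_orbit x)).trans ?_
  exact Eventually.of_forall (hT.fourier_orbit x)

theorem memLp_res_axisPoint (x : X) :
    MemLp (fun ξ => hT.res (axisPoint ξ) x) 2 (volume : Measure ℝ) :=
  (Lp.memLp _).ae_eq (hT.fourier_orbitL2 x)

end IsExponentiallyStable

end C0Semigroup

/-! ### The Poisson form of a dissipative generator -/

theorem integral_inv_sq_add_two_pi_mul_sq {N : ℝ} (hN : 0 < N) :
    ∫ ξ : ℝ, (N ^ 2 + (2 * Real.pi * ξ) ^ 2)⁻¹ = (2 * N)⁻¹ := by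
  have h := Measure.integral_comp_mul_left (fun y : ℝ => (1 + y ^ 2)⁻¹) (2 * Real.pi / N)
  rw [integral_univ_inv_one_add_sq] at h
  have h2 : ∀ ξ : ℝ, (N ^ 2 + (2 * Real.pi * ξ) ^ 2)⁻¹ =
      (N ^ 2)⁻¹ * (1 + (2 * Real.pi / N * ξ) ^ 2)⁻¹ := by
    intro ξ
    field_simp
  simp only [h2]
  have hpi := Real.pi_pos
  rw [integral_const_mul, h, abs_of_pos (by positivity), smul_eq_mul]
  field_simp

namespace C0Semigroup.IsExponentiallyStable

variable {X : Type*} [NormedAddCommGroup X] [InnerProductSpace ℂ X]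
  {T : C0Semigroup X} (hT : T.IsExponentiallyStable)

/-- The sesquilinear form `⟨y, r x⟩ + ⟨r y, x⟩`, where `r` is the resolvent at the point `2πiξ`. -/
noncomputable def poissonForm (y x : X) (ξ : ℝ) : ℂ :=
  inner ℂ y (hT.res (axisPoint ξ) x) + inner ℂ (hT.res (axisPoint ξ) y) x

theorem poissonForm_add_right (y x x' : X) (ξ : ℝ) :
    hT.poissonForm y (x + x') ξ = hT.poissonForm y x ξ + hT.poissonForm y x' ξ := by
  simp only [poissonForm, map_add, inner_add_right]; ring

theorem poissonForm_add_left (y y' x : X) (ξ : ℝ) :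
    hT.poissonForm (y + y') x ξ = hT.poissonForm y x ξ + hT.poissonForm y' x ξ := by
  simp only [poissonForm, map_add, inner_add_left]; ring

theorem poissonForm_smul_right (c : ℂ) (y x : X) (ξ : ℝ) :
    hT.poissonForm y (c • x) ξ = c * hT.poissonForm y x ξ := by
  simp only [poissonForm, map_smul, inner_smul_right]; ring

theorem poissonForm_smul_left (c : ℂ) (y x : X) (ξ : ℝ) :
    hT.poissonForm (c • y) x ξ = (starRingEnd ℂ) c * hT.poissonForm y x ξ := by
  simp only [poissonForm, map_smul, inner_smul_left]; ring

theorem conj_poissonForm (y x : X) (ξ : ℝ) :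
    (starRingEnd ℂ) (hT.poissonForm y x ξ) = hT.poissonForm x y ξ := by
  simp only [poissonForm, map_add, inner_conj_symm]; ring

theorem poissonForm_self_re (x : X) (ξ : ℝ) :
    (hT.poissonForm x x ξ).re = 2 * (inner ℂ (hT.res (axisPoint ξ) x) x : ℂ).re := by
  rw [poissonForm, Complex.add_re, ← inner_conj_symm x, Complex.conj_re]; ring

variable [CompleteSpace X] {A : X →ₗ.[ℂ] X} (hA : T.IsGenerator A)

include hA

theorem continuous_res_axisPoint (x : X) : Continuous fun ξ => hT.res (axisPoint ξ) x :=
  ((hT.continuousOn_res hA).comp_continuous continuous_axisPoint fun ξ => by simp).clm_apply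
    continuous_const

theorem continuous_poissonForm (y x : X) : Continuous (hT.poissonForm y x) := by
  have h1 := hT.continuous_res_axisPoint hA x
  have h2 := hT.continuous_res_axisPoint hA y
  unfold poissonForm
  exact (continuous_const.inner h1).add (h2.inner continuous_const)

/-- The Poisson integral formula at N for the bounded conjugate-analytic extension of ⟨R(iω)x, x⟩,
deduced from Cauchy's theorem with the kernel (N - s)⁻². -/
theorem integral_inner_res_mul_poisson {N : ℝ} (hN : 0 < N) (x : X) :
    ∫ ξ : ℝ, (inner ℂ (hT.res (axisPoint ξ) x) x : ℂ) * (((N ^ 2 + (2 * Real.pi * ξ) ^ 2)⁻¹ : ℝ) : ℂ) =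
      inner ℂ (hT.res N x) x * ((2 * N)⁻¹ : ℝ) := by
  have hNre : (0 : ℝ) ≤ (N : ℂ).re := by simpa using hN.le
  set c : ℂ := inner ℂ (hT.res N x) x with hc
  -- With v = ⟨R(iω)x, x⟩, the resolvent identity gives ⟨R(iω)R(N)x, x⟩ = (v - c)/(N + iω). The
  -- boundary value of `f` is therefore (v - c)(N - iω)/(N + iω), and division by (N - iω)² leaves
  -- (v - c)/(N² + ω²).
  set f : ℂ → ℂ := fun s => 2 * N * inner ℂ (hT.res (-(starRingEnd ℂ) s) (hT.res N x)) x + c -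
    inner ℂ (hT.res (-(starRingEnd ℂ) s) x) x with hf
  obtain ⟨C₁, hC₁⟩ := hT.exists_norm_inner_res_le (hT.res N x) x
  obtain ⟨C₂, hC₂⟩ := hT.exists_norm_inner_res_le x x
  have h0 := integral_boundary_div_sq_eq_zero (f := f) (M := ‖(2 * N : ℂ)‖ * C₁ + ‖c‖ + C₂)
    (N := N) (β := fun ξ => 2 * N * inner ℂ (hT.res (axisPoint ξ) (hT.res N x)) x + c -
      inner ℂ (hT.res (axisPoint ξ) x) x)
    (((hT.differentiableOn_inner_res hA _ x).const_mul _ |>.add_const c).sub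
      (hT.differentiableOn_inner_res hA x x))
    (fun s _ => by
      refine (norm_sub_le _ _).trans (add_le_add ((norm_add_le _ _).trans ?_) (hC₂ s))
      rw [norm_mul]
      gcongr
      exact hC₁ s)
    (by
      filter_upwards [hT.hasBoundaryValues_inner_res hA (hT.res N x) x,
        hT.hasBoundaryValues_inner_res hA x x] with ξ h1 h2
      exact ((h1.const_mul _).add_const c).sub h2) hN
  have hker : ∀ ξ : ℝ, (2 * N * inner ℂ (hT.res (axisPoint ξ) (hT.res N x)) x + c -
      inner ℂ (hT.res (axisPoint ξ) x) x) / (N - axisPoint ξ) ^ 2 =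
      (inner ℂ (hT.res (axisPoint ξ) x) x : ℂ) * (((N ^ 2 + (2 * Real.pi * ξ) ^ 2)⁻¹ : ℝ) : ℂ) -
        c * (((N ^ 2 + (2 * Real.pi * ξ) ^ 2)⁻¹ : ℝ) : ℂ) := by
    intro ξ
    have h1 := congrArg (fun z => (inner ℂ z x : ℂ))
      (hT.res_sub_res hA (a := axisPoint ξ) (b := (N : ℂ)) (by simp) hNre x)
    simp only [inner_sub_left, inner_smul_left, map_sub, conj_axisPoint, Complex.conj_ofReal] at h1
    have hm : (N : ℂ) - axisPoint ξ ≠ 0 :=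
      sub_ne_zero_of_re_pos (by simpa using hN) (by simp)
    have hp : (N : ℂ) + axisPoint ξ ≠ 0 := by
      have := sub_ne_zero_of_re_pos (a := (N : ℂ)) (s := -axisPoint ξ) (by simpa using hN) (by simp)
      rwa [sub_neg_eq_add] at this
    have hprod : (((N ^ 2 + (2 * Real.pi * ξ) ^ 2)⁻¹ : ℝ) : ℂ) =
        ((N - axisPoint ξ) * (N + axisPoint ξ))⁻¹ := by
      rw [axisPoint_eq_mul_I]
      push_cast
      congr 1
      linear_combination (2 * Real.pi * ξ : ℂ) ^ 2 * Complex.I_sq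
    rw [hprod]
    set u : ℂ := inner ℂ (hT.res (axisPoint ξ) (hT.res N x)) x
    set v : ℂ := inner ℂ (hT.res (axisPoint ξ) x) x
    have h2 : u = (v - c) / (N + axisPoint ξ) := by
      rw [eq_div_iff hp]
      linear_combination h1
    rw [h2]
    field_simp
    ring
  simp only [hker] at h0
  have hi1 : Integrable fun ξ : ℝ => c * (((N ^ 2 + (2 * Real.pi * ξ) ^ 2)⁻¹ : ℝ) : ℂ) :=
    ((integrable_norm_inv_sq hN).ofReal).const_mul c
  have hi2 : Integrable fun ξ : ℝ =>
      (inner ℂ (hT.res (axisPoint ξ) x) x : ℂ) * (((N ^ 2 + (2 * Real.pi * ξ) ^ 2)⁻¹ : ℝ) : ℂ) := by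
    refine ((integrable_norm_inv_sq hN).ofReal).bdd_mul (c := C₂)
      ((hT.continuous_res_axisPoint hA x).inner continuous_const).aestronglyMeasurable
      (Eventually.of_forall fun ξ => ?_)
    simpa [conj_axisPoint] using hC₂ (axisPoint ξ)
  rw [integral_sub hi2 hi1, integral_const_mul, integral_complex_ofReal, integral_inv_sq_add_two_pi_mul_sq hN,
    sub_eq_zero] at h0
  exact h0

variable (hd : IsDissipativeOp A)

include hd

/-- Dissipativity at the vector R(a)x, where A R(a)x = a R(a)x - x. -/
theorem re_mul_norm_sq_res_le {a : ℂ} (ha : 0 ≤ a.re) (x : X) :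
    a.re * ‖hT.res a x‖ ^ 2 ≤ (inner ℂ (hT.res a x) x : ℂ).re := by
  obtain ⟨z, hz, hz'⟩ := (LinearPMap.mem_graph_iff _).1 (hT.res_mem_graph hA ha x)
  simp only at hz hz'
  have h1 := hd z
  rw [hz', hz, Complex.add_re, ← inner_conj_symm _ (hT.res a x), Complex.conj_re,
    inner_sub_right, inner_smul_right, Complex.sub_re, inner_self_eq_norm_sq_to_K] at h1
  have h2 : (a * ((‖hT.res a x‖ : ℂ)) ^ 2).re = a.re * ‖hT.res a x‖ ^ 2 := by
    rw [← Complex.ofReal_pow, Complex.re_mul_ofReal]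
  have h3 : (a * (((‖hT.res a x‖ : ℝ) : ℂ)) ^ 2).re - (inner ℂ (hT.res a x) x : ℂ).re ≤ 0 := by
    have h4 := h1
    simp only [Complex.coe_algebraMap] at h4
    linarith
  linarith

theorem poissonForm_self_nonneg (x : X) (ξ : ℝ) : 0 ≤ (hT.poissonForm x x ξ).re := by
  have := hT.re_mul_norm_sq_res_le hA hd (a := axisPoint ξ) (by simp) x
  rw [poissonForm_self_re]
  simp only [axisPoint_re, zero_mul] at this
  linarith

theorem mul_re_inner_res_le {N : ℝ} (hN : 0 < N) (x : X) :
    N * (inner ℂ (hT.res N x) x : ℂ).re ≤ ‖x‖ ^ 2 := by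
  have h1 := hT.re_mul_norm_sq_res_le hA hd (a := N) (by simpa using hN.le) x
  have h2 := (Complex.re_le_norm _).trans (norm_inner_le_norm (𝕜 := ℂ) (hT.res N x) x)
  rw [Complex.ofReal_re] at h1
  have h3 : N * ‖hT.res N x‖ ≤ ‖x‖ := by
    rcases (norm_nonneg (hT.res N x)).eq_or_lt with h0 | h0
    · rw [← h0, mul_zero]; exact norm_nonneg x
    · refine le_of_mul_le_mul_right ?_ h0
      linarith [h1.trans h2]
  calc _ ≤ N * (‖hT.res N x‖ * ‖x‖) := by gcongr
    _ = (N * ‖hT.res N x‖) * ‖x‖ := by ring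
    _ ≤ ‖x‖ * ‖x‖ := by gcongr
    _ = _ := by ring

/-- Weighted by N²/(N² + ω²), the integral equals N Re⟨R(N)x, x⟩ ≤ ‖x‖². The weights tend to 1, and
since the form is nonnegative Fatou's lemma removes them; integrability of P(x,x) is a consequence,
not an assumption. -/
theorem lintegral_poissonForm_self_le (x : X) :
    ∫⁻ ξ : ℝ, ENNReal.ofReal (hT.poissonForm x x ξ).re ≤ ENNReal.ofReal (‖x‖ ^ 2) := by
  have hcont : Continuous fun ξ => (hT.poissonForm x x ξ).re :=
    Complex.continuous_re.comp (hT.continuous_poissonForm hA x x)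
  set w : ℕ → ℝ → ℝ := fun n ξ => ((n : ℝ) + 1) ^ 2 * (((n : ℝ) + 1) ^ 2 + (2 * Real.pi * ξ) ^ 2)⁻¹
    with hw
  have hw0 : ∀ n ξ, 0 ≤ w n ξ := fun n ξ => by positivity
  have hwc : ∀ n, Continuous (w n) := fun n => by
    refine Continuous.mul continuous_const (Continuous.inv₀ (by fun_prop) fun ξ => ?_)
    positivity
  have hbound : ∀ n : ℕ, ∫⁻ ξ : ℝ, ENNReal.ofReal ((hT.poissonForm x x ξ).re * w n ξ) ≤
      ENNReal.ofReal (‖x‖ ^ 2) := by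
    intro n
    have hn : (0 : ℝ) < (n : ℝ) + 1 := by positivity
    have hi : Integrable fun ξ : ℝ => (inner ℂ (hT.res (axisPoint ξ) x) x : ℂ) *
        (((((n : ℝ) + 1) ^ 2 + (2 * Real.pi * ξ) ^ 2)⁻¹ : ℝ) : ℂ) := by
      obtain ⟨C₂, hC₂⟩ := hT.exists_norm_inner_res_le x x
      refine ((integrable_norm_inv_sq hn).ofReal).bdd_mul (c := C₂)
        ((hT.continuous_res_axisPoint hA x).inner continuous_const).aestronglyMeasurable
        (Eventually.of_forall fun ξ => ?_)
      simpa [conj_axisPoint] using hC₂ (axisPoint ξ)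
    have heq : ∀ ξ, (hT.poissonForm x x ξ).re * w n ξ = (2 * ((n : ℝ) + 1) ^ 2) *
        RCLike.re ((inner ℂ (hT.res (axisPoint ξ) x) x : ℂ) *
        (((((n : ℝ) + 1) ^ 2 + (2 * Real.pi * ξ) ^ 2)⁻¹ : ℝ) : ℂ)) := by
      intro ξ
      rw [poissonForm_self_re]
      show _ = _ * (Complex.re _)
      rw [Complex.re_mul_ofReal]
      simp only [hw]
      ring
    rw [← ofReal_integral_eq_lintegral_ofReal]
    · refine ENNReal.ofReal_le_ofReal ?_
      simp only [heq]
      rw [integral_const_mul, integral_re hi, hT.integral_inner_res_mul_poisson hA hn]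
      show _ * (Complex.re _) ≤ _
      rw [Complex.re_mul_ofReal]
      refine le_trans (le_of_eq ?_) (hT.mul_re_inner_res_le hA hd hn x)
      field_simp
    · simp only [heq]
      exact hi.re.const_mul _
    · exact Eventually.of_forall fun ξ =>
        mul_nonneg (hT.poissonForm_self_nonneg hA hd x ξ) (hw0 n ξ)
  have hlim : ∀ ξ, Tendsto (fun n => ENNReal.ofReal ((hT.poissonForm x x ξ).re * w n ξ)) atTop
      (𝓝 (ENNReal.ofReal (hT.poissonForm x x ξ).re)) := by
    intro ξ
    refine (ENNReal.continuous_ofReal.tendsto _).comp ?_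
    have h1 : Tendsto (fun n : ℕ => ((n : ℝ) + 1)⁻¹) atTop (𝓝 0) := by
      simpa using tendsto_one_div_add_atTop_nhds_zero_nat (𝕜 := ℝ)
    have h2 : ContinuousAt (fun z : ℝ => (hT.poissonForm x x ξ).re *
        (1 + (z * (2 * Real.pi * ξ)) ^ 2)⁻¹) 0 :=
      ContinuousAt.mul continuousAt_const (ContinuousAt.inv₀ (by fun_prop) (by positivity))
    have h3 := h2.tendsto.comp h1
    simp only [zero_mul, ne_eq, OfNat.ofNat_ne_zero, not_false_eq_true, zero_pow, add_zero,
      inv_one, mul_one] at h3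
    refine h3.congr fun n => ?_
    simp only [Function.comp_apply, hw]
    field_simp
  calc ∫⁻ ξ : ℝ, ENNReal.ofReal (hT.poissonForm x x ξ).re
      = ∫⁻ ξ : ℝ, liminf (fun n => ENNReal.ofReal ((hT.poissonForm x x ξ).re * w n ξ)) atTop := by
        simp only [(hlim _).liminf_eq]
    _ ≤ liminf (fun n => ∫⁻ ξ : ℝ, ENNReal.ofReal ((hT.poissonForm x x ξ).re * w n ξ)) atTop :=
        lintegral_liminf_le fun n => (hcont.mul (hwc n)).measurable.ennreal_ofReal
    _ ≤ ENNReal.ofReal (‖x‖ ^ 2) := by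
        refine (liminf_le_liminf (Eventually.of_forall hbound)).trans ?_
        simp

theorem integrable_poissonForm_self (x : X) : Integrable fun ξ => (hT.poissonForm x x ξ).re := by
  refine ⟨(Complex.continuous_re.comp (hT.continuous_poissonForm hA x x)).aestronglyMeasurable, ?_⟩
  rw [hasFiniteIntegral_iff_ofReal
    (Eventually.of_forall fun ξ => hT.poissonForm_self_nonneg hA hd x ξ)]
  exact (hT.lintegral_poissonForm_self_le hA hd x).trans_lt ENNReal.ofReal_lt_top

theorem integral_poissonForm_self_le (x : X) :
    ∫ ξ : ℝ, (hT.poissonForm x x ξ).re ≤ ‖x‖ ^ 2 := by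
  rw [integral_eq_lintegral_of_nonneg_ae
    (Eventually.of_forall fun ξ => hT.poissonForm_self_nonneg hA hd x ξ)
    (Complex.continuous_re.comp (hT.continuous_poissonForm hA x x)).aestronglyMeasurable]
  exact ENNReal.toReal_le_of_le_ofReal (by positivity) (hT.lintegral_poissonForm_self_le hA hd x)

/-- The arithmetic-mean form of Cauchy–Schwarz for a positive form: expand P at x - wy, with the
phase w = p/|p| chosen so that both cross terms equal -|p|. -/
theorem norm_poissonForm_le (y x : X) (ξ : ℝ) :
    ‖hT.poissonForm y x ξ‖ ≤ ((hT.poissonForm x x ξ).re + (hT.poissonForm y y ξ).re) / 2 := by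
  set p := hT.poissonForm y x ξ with hp
  have hx := hT.poissonForm_self_nonneg hA hd x ξ
  have hy := hT.poissonForm_self_nonneg hA hd y ξ
  rcases eq_or_ne p 0 with h0 | h0
  · rw [h0, norm_zero]; positivity
  set w : ℂ := p / ‖p‖ with hw
  have hn : (‖p‖ : ℂ) ≠ 0 := by exact_mod_cast norm_ne_zero_iff.2 h0
  have hpp : (starRingEnd ℂ) p * p = ‖p‖ * ‖p‖ := by
    rw [mul_comm, Complex.mul_conj, Complex.normSq_eq_norm_sq]; push_cast; ring
  have hcw : (starRingEnd ℂ) w * p = ‖p‖ := by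
    rw [hw, map_div₀, Complex.conj_ofReal, div_mul_eq_mul_div, hpp]; field_simp
  have hcw' : w * (starRingEnd ℂ) p = ‖p‖ := by
    have := congrArg (starRingEnd ℂ) hcw
    simpa using this
  have hww : (starRingEnd ℂ) w * w = 1 := by
    rw [hw, ← hw]
    conv_lhs => rw [hw]
    rw [map_div₀, Complex.conj_ofReal, div_mul_div_comm, hpp]; field_simp
  have h1 := hT.poissonForm_self_nonneg hA hd (x + (-w) • y) ξ
  have h2 : hT.poissonForm (x + (-w) • y) (x + (-w) • y) ξ =
      hT.poissonForm x x ξ + hT.poissonForm y y ξ - 2 * ‖p‖ := by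
    simp only [poissonForm_add_left, poissonForm_add_right, poissonForm_smul_left,
      poissonForm_smul_right, ← hT.conj_poissonForm y x, ← hp, map_neg]
    linear_combination (hT.poissonForm y y ξ) * hww - hcw - hcw'
  rw [h2, Complex.sub_re, Complex.add_re] at h1
  have h3 : (2 * (‖p‖ : ℂ)).re = 2 * ‖p‖ := by simp
  rw [h3] at h1
  linarith

theorem integrable_poissonForm (y x : X) : Integrable (hT.poissonForm y x) := by
  refine (((hT.integrable_poissonForm_self hA hd x).add
    (hT.integrable_poissonForm_self hA hd y)).div_const 2).mono'
    (hT.continuous_poissonForm hA y x).aestronglyMeasurable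
    (Eventually.of_forall fun ξ => hT.norm_poissonForm_le hA hd y x ξ)

/-! ### Operators obtained by integrating a bounded function against the Poisson form. -/

section Form

variable {b : ℝ → ℂ} {K : ℝ} (hb : AEStronglyMeasurable b volume) (hK : ∀ᵐ ξ, ‖b ξ‖ ≤ K)

include hb hK

theorem integrable_mul_poissonForm (y x : X) : Integrable fun ξ => b ξ * hT.poissonForm y x ξ :=
  (hT.integrable_poissonForm hA hd y x).bdd_mul hb hK

omit hb in
theorem norm_integral_mul_poissonForm_le (y x : X) :
    ‖∫ ξ, b ξ * hT.poissonForm y x ξ‖ ≤ K * ‖y‖ * ‖x‖ := by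
  have hK0 : 0 ≤ K := by
    obtain ⟨ξ, hξ⟩ := hK.exists
    exact (norm_nonneg _).trans hξ
  have hmean : ∀ y x : X, ‖∫ ξ, b ξ * hT.poissonForm y x ξ‖ ≤ K * ((‖x‖ ^ 2 + ‖y‖ ^ 2) / 2) := by
    intro y x
    have hix := hT.integrable_poissonForm_self hA hd x
    have hiy := hT.integrable_poissonForm_self hA hd y
    refine (norm_integral_le_of_norm_le (((hix.add hiy).div_const 2).const_mul K) ?_).trans ?_
    · filter_upwards [hK] with ξ hξ
      rw [norm_mul]
      exact mul_le_mul hξ (hT.norm_poissonForm_le hA hd y x ξ) (norm_nonneg _) hK0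
    · rw [integral_const_mul, integral_div]
      simp only [Pi.add_apply]
      rw [integral_add hix hiy]
      gcongr
      · exact hT.integral_poissonForm_self_le hA hd x
      · exact hT.integral_poissonForm_self_le hA hd y
  rcases eq_or_ne x 0 with rfl | hx
  · have := hmean 0 0
    simp [poissonForm]
  rcases eq_or_ne y 0 with rfl | hy
  · simp [poissonForm]
  have hx' := norm_pos_iff.2 hx
  have hy' := norm_pos_iff.2 hy
  -- Rescaling both vectors to the common norm ‖x‖‖y‖ turns the arithmetic mean into the product
  -- ‖y‖‖x‖.
  have h1 := hmean ((‖x‖ : ℂ) • y) ((‖y‖ : ℂ) • x)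
  have h2 : ∀ ξ, b ξ * hT.poissonForm ((‖x‖ : ℂ) • y) ((‖y‖ : ℂ) • x) ξ =
      (((‖x‖ * ‖y‖ : ℝ)) : ℂ) * (b ξ * hT.poissonForm y x ξ) := by
    intro ξ
    rw [poissonForm_smul_left, poissonForm_smul_right, Complex.conj_ofReal]
    push_cast
    ring
  simp only [h2] at h1
  rw [integral_const_mul, norm_mul, Complex.norm_real, Real.norm_of_nonneg (by positivity),
    norm_smul, norm_smul, Complex.norm_real, Complex.norm_real, norm_norm, norm_norm] at h1
  refine le_of_mul_le_mul_left (h1.trans (le_of_eq ?_)) (mul_pos hx' hy')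
  ring

/-- The operator `∫ b(ξ) dP(ξ)` of a bounded function, where `P` is given by the Poisson form. -/
theorem exists_clm_inner_eq_integral : ∃ Φ : X →L[ℂ] X,
    (∀ y x, inner ℂ y (Φ x) = ∫ ξ, b ξ * hT.poissonForm y x ξ) ∧ ‖Φ‖ ≤ K := by
  have hint := hT.integrable_mul_poissonForm hA hd hb hK
  have hbd := hT.norm_integral_mul_poissonForm_le hA hd hK
  have hK0 : 0 ≤ K := by
    obtain ⟨ξ, hξ⟩ := hK.exists
    exact (norm_nonneg _).trans hξ
  let B : X →ₗ⋆[ℂ] X →ₗ[ℂ] ℂ := LinearMap.mk₂'ₛₗ (starRingEnd ℂ) (RingHom.id ℂ)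
    (fun y x => ∫ ξ, b ξ * hT.poissonForm y x ξ)
    (fun y y' x => by
      rw [← integral_add (hint y x) (hint y' x)]
      simp only [poissonForm_add_left, mul_add])
    (fun c y x => by
      rw [smul_eq_mul, ← integral_const_mul]
      simp only [poissonForm_smul_left, mul_left_comm])
    (fun y x x' => by
      rw [← integral_add (hint y x) (hint y x')]
      simp only [poissonForm_add_right, mul_add])
    (fun c y x => by
      rw [RingHom.id_apply, smul_eq_mul, ← integral_const_mul]
      simp only [poissonForm_smul_right, mul_left_comm])
  let B' : X →L⋆[ℂ] X →L[ℂ] ℂ := B.mkContinuous₂ K hbd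
  -- The operator representing the form acts on the left argument y; its adjoint acts on x.
  have hΦ : ∀ y x, inner ℂ y (ContinuousLinearMap.adjoint
      (InnerProductSpace.continuousLinearMapOfBilin B') x) = ∫ ξ, b ξ * hT.poissonForm y x ξ := by
    intro y x
    rw [ContinuousLinearMap.adjoint_inner_right,
      InnerProductSpace.continuousLinearMapOfBilin_apply]
    rfl
  refine ⟨_, hΦ, ContinuousLinearMap.opNorm_le_bound _ hK0 fun x => ?_⟩
  set z := ContinuousLinearMap.adjoint (InnerProductSpace.continuousLinearMapOfBilin B') x with hz
  rcases (norm_nonneg z).eq_or_lt with h0 | h0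
  · rw [← h0]; positivity
  · refine le_of_mul_le_mul_left ?_ h0
    have h1 := hbd z x
    rw [← hΦ, ← hz, inner_self_eq_norm_sq_to_K, norm_pow] at h1
    simp only [Complex.coe_algebraMap, Complex.norm_real, norm_norm] at h1
    linarith

end Form

end C0Semigroup.IsExponentiallyStable

/-! ### Boundary functions in `H^∞` -/

theorem zeroExtend_of_mem (g : leftHalfPlane →ᵇ ℂ) {s : ℂ} (hs : s ∈ leftHalfPlane) :
    zeroExtend g s = g ⟨s, hs⟩ := dif_pos hs

theorem norm_zeroExtend_le (g : HInfMinus) (s : ℂ) : ‖zeroExtend g.1 s‖ ≤ ‖g‖ := by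
  by_cases hs : s ∈ leftHalfPlane
  · rw [zeroExtend_of_mem _ hs]
    exact g.1.norm_coe_le_norm _
  · rw [zeroExtend, dif_neg hs, norm_zero]
    exact norm_nonneg _

theorem ofReal_add_axisPoint_mem {σ : ℝ} (hσ : σ < 0) (ξ : ℝ) :
    (σ : ℂ) + axisPoint ξ ∈ leftHalfPlane := by
  simpa [leftHalfPlane] using hσ

theorem exists_isBoundaryFunction (g : HInfMinus) :
    ∃ b : Lp ℂ ∞ (volume : Measure ℝ), IsBoundaryFunction g b := by
  have hF : ∀ᵐ ξ : ℝ, ∃ c : ℂ, Tendsto (fun σ : ℝ => zeroExtend g.1 (σ + axisPoint ξ))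
      (𝓝[<] 0) (𝓝 c) := ae_exists_tendsto_boundary g.2 fun s _ => norm_zeroExtend_le g s
  -- Where the limit fails to exist `limUnder` is an arbitrary value, but this happens only on a
  -- null set. Measurability comes from the sequence σ = -1/(n + 1).
  set β : ℝ → ℂ := fun ξ => limUnder (𝓝[<] (0 : ℝ)) fun σ : ℝ => zeroExtend g.1 (σ + axisPoint ξ)
  have hβ : HasBoundaryValues (zeroExtend g.1) β := by
    filter_upwards [hF] with ξ hξ using tendsto_nhds_limUnder hξ
  have hσ : ∀ n : ℕ, -((n : ℝ) + 1)⁻¹ < 0 := fun n => by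
    have : (0 : ℝ) < (n + 1 : ℝ)⁻¹ := by positivity
    linarith
  have hlim : Tendsto (fun n : ℕ => -((n : ℝ) + 1)⁻¹) atTop (𝓝[<] 0) := by
    refine tendsto_nhdsWithin_iff.2 ⟨?_, Eventually.of_forall hσ⟩
    simpa using (tendsto_one_div_add_atTop_nhds_zero_nat (𝕜 := ℝ)).neg
  have hmeas : AEStronglyMeasurable β volume := by
    refine aestronglyMeasurable_of_tendsto_ae atTop
      (f := fun (n : ℕ) ξ => zeroExtend g.1 ((-((n : ℝ) + 1)⁻¹ : ℝ) + axisPoint ξ)) (fun n => ?_) ?_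
    · refine Continuous.aestronglyMeasurable ?_
      exact g.2.continuousOn.comp_continuous (by fun_prop)
        fun ξ => ofReal_add_axisPoint_mem (hσ n) ξ
    · filter_upwards [hβ] with ξ hξ using hξ.comp hlim
  have hbound : ∀ᵐ ξ, ‖β ξ‖ ≤ ‖g‖ := by
    filter_upwards [hβ] with ξ hξ
    exact le_of_tendsto hξ.norm (Eventually.of_forall fun σ => norm_zeroExtend_le g _)
  have hmem := memLp_top_of_bound hmeas _ hbound
  refine ⟨hmem.toLp β, ?_⟩
  filter_upwards [hβ, hmem.coeFn_toLp] with ξ hξ h1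
  rw [h1]
  exact hξ

namespace IsBoundaryFunction

variable {g h : HInfMinus} {b c : Lp ℂ ∞ (volume : Measure ℝ)}

theorem hasBoundaryValues (hb : IsBoundaryFunction g b) : HasBoundaryValues (zeroExtend g.1) b := hb

theorem ae_norm_le (hb : IsBoundaryFunction g b) : ∀ᵐ ξ, ‖b ξ‖ ≤ ‖g‖ := by
  filter_upwards [hb] with ξ hξ
  exact le_of_tendsto hξ.norm (Eventually.of_forall fun σ => norm_zeroExtend_le g _)

theorem ae_eq_of_tendsto (hb : IsBoundaryFunction g b) {β : ℝ → ℂ}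
    (hβ : HasBoundaryValues (zeroExtend g.1) β) : ∀ᵐ ξ, b ξ = β ξ := by
  filter_upwards [hb, hβ] with ξ h1 h2 using tendsto_nhds_unique h1 h2

theorem integral_mul_eq_zero (hb : IsBoundaryFunction g b) {F : ℂ → ℂ} {φ : ℝ → ℂ} {M : ℝ}
    (hF : DifferentiableOn ℂ F leftHalfPlane) (hM : ∀ s ∈ leftHalfPlane, ‖F s‖ ≤ M)
    (hφ : HasBoundaryValues F φ) (hint : Integrable fun ξ => b ξ * φ ξ) :
    ∫ ξ, b ξ * φ ξ = 0 := by
  refine integral_boundary_eq_zero (f := fun s => zeroExtend g.1 s * F s) (M := ‖g‖ * M)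
    (DifferentiableOn.mul g.2 hF) (fun s hs => ?_) ?_ hint
  · rw [norm_mul]
    exact mul_le_mul (norm_zeroExtend_le g s) (hM s hs) (norm_nonneg _) (norm_nonneg _)
  · filter_upwards [hb.hasBoundaryValues, hφ] with ξ h1 h2 using h1.mul h2

end IsBoundaryFunction

theorem hasBoundaryValues_of_eqOn {f : ℂ → ℂ} {β : ℝ → ℂ} {F : ℂ → ℂ}
    (hF : ∀ s ∈ leftHalfPlane, f s = F s) (hβ : HasBoundaryValues F β) : HasBoundaryValues f β := by
  filter_upwards [hβ] with ξ hξ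
  refine hξ.congr' ?_
  filter_upwards [self_mem_nhdsWithin] with σ hσ
  exact (hF _ (ofReal_add_axisPoint_mem hσ ξ)).symm

/-! ### Exponentials -/

section InvSub

variable {a : ℂ} (ha : 0 < a.re)

include ha

theorem differentiableOn_inv_sub : DifferentiableOn ℂ (fun s => (a - s)⁻¹) leftHalfPlane :=
  DifferentiableOn.inv (by fun_prop) fun _ hs => sub_ne_zero_of_re_pos ha (le_of_lt hs)

theorem norm_inv_sub_le {s : ℂ} (hs : s.re ≤ 0) : ‖(a - s)⁻¹‖ ≤ a.re⁻¹ := by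
  rw [norm_inv]
  refine inv_anti₀ ha ((le_trans ?_ (Complex.re_le_norm _)))
  rw [Complex.sub_re]
  linarith

theorem hasBoundaryValues_inv_sub :
    HasBoundaryValues (fun s => (a - s)⁻¹) fun ξ => (a - axisPoint ξ)⁻¹ := by
  refine Eventually.of_forall fun ξ => ?_
  have h1 : ContinuousAt (fun σ : ℝ => (a - (σ + axisPoint ξ))⁻¹) 0 :=
    ContinuousAt.inv₀ (by fun_prop) (by
      simpa using sub_ne_zero_of_re_pos ha (s := axisPoint ξ) (by simp))
  simpa using h1.tendsto.mono_left nhdsWithin_le_nhds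

end InvSub

/-- The function `e^{-at}` on `(0, ∞)`, extended by zero. -/
noncomputable def expPos (a : ℂ) : ℝ → ℂ :=
  (Set.Ioi (0 : ℝ)).indicator fun t : ℝ => Complex.exp (-a * t)

section ExpPos

variable {X : Type*} [NormedAddCommGroup X] [InnerProductSpace ℂ X] {a : ℂ} (ha : 0 < a.re)

include ha

theorem integrable_expPos_smul (y : X) : Integrable fun t => expPos a t • y := by
  refine Integrable.smul_const ?_ y
  rw [expPos, integrable_indicator_iff measurableSet_Ioi]
  exact integrableOn_exp_mul_complex_Ioi (by simpa using ha) 0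

theorem memLp_expPos_smul (y : X) : MemLp (fun t => expPos a t • y) 2 (volume : Measure ℝ) := by
  refine (memLp_exp_indicator ha).of_le_mul (c := ‖y‖) (integrable_expPos_smul ha y).1
    (Eventually.of_forall fun t => ?_)
  rw [norm_smul, mul_comm]
  rfl

theorem expPos_mem_L2Pos (y : X) : (memLp_expPos_smul ha y).toLp _ ∈ L2Pos X := by
  rw [mem_L2Pos_iff]
  filter_upwards [(memLp_expPos_smul ha y).coeFn_toLp] with t ht ht0
  rw [ht, expPos, Set.indicator_of_notMem (by simpa using ht0), zero_smul]

variable [CompleteSpace X]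

theorem fourier_expPos_smul (y : X) (ξ : ℝ) :
    𝓕 (fun t => expPos a t • y) ξ = (a + axisPoint ξ)⁻¹ • y := by
  rw [fourier_eq_integral_exp]
  simp only [smul_smul]
  rw [integral_smul_const]
  congr 1
  have h1 := integral_exp_mul_complex_Ioi (a := -(a + axisPoint ξ)) (by simpa using ha) 0
  rw [Complex.ofReal_zero, mul_zero, Complex.exp_zero, neg_div_neg_eq, one_div] at h1
  rw [← h1, ← integral_indicator measurableSet_Ioi]
  refine integral_congr_ae (Eventually.of_forall fun t => ?_)
  by_cases ht : 0 < t
  · simp only [expPos, Set.indicator_of_mem (Set.mem_Ioi.2 ht), ← Complex.exp_add]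
    congr 1
    ring
  · simp [expPos, ht]

theorem fourier_toLp_expPos (y : X) :
    (𝓕 ((memLp_expPos_smul ha y).toLp _) : Lp X 2 (volume : Measure ℝ)) =ᵐ[volume]
      fun ξ => (a + axisPoint ξ)⁻¹ • y :=
  (fourier_toLp_ae_eq (integrable_expPos_smul ha y) (memLp_expPos_smul ha y)).trans
    (Eventually.of_forall fun ξ => fourier_expPos_smul ha y ξ)

theorem memLp_inv_add_axisPoint_smul (y : X) :
    MemLp (fun ξ => (a + axisPoint ξ)⁻¹ • y) 2 (volume : Measure ℝ) :=
  (Lp.memLp _).ae_eq (fourier_toLp_expPos ha y)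

omit [InnerProductSpace ℂ X] [CompleteSpace X] [NormedAddCommGroup X] in
theorem memLp_inv_sub_axisPoint :
    MemLp (fun ξ => (a - axisPoint ξ)⁻¹) 2 (volume : Measure ℝ) := by
  have h := memLp_inv_add_axisPoint_smul (a := (starRingEnd ℂ) a) (by simpa using ha) (1 : ℂ)
  refine h.mono (Continuous.aestronglyMeasurable ?_) (Eventually.of_forall fun ξ => ?_)
  · exact Continuous.inv₀ (by fun_prop) fun ξ => sub_ne_zero_of_re_pos ha (by simp)
  · rw [smul_eq_mul, mul_one, norm_inv, norm_inv, ← Complex.norm_conj, map_sub, conj_axisPoint,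
      sub_neg_eq_add]

omit [CompleteSpace X] in
theorem integrable_inv_sub_mul_inner (y : X) {f : ℝ → X} (hf : MemLp f 2 (volume : Measure ℝ)) :
    Integrable fun ξ => (a - axisPoint ξ)⁻¹ * inner ℂ y (f ξ) :=
  (memLp_inv_sub_axisPoint ha).integrable_mul (hf.const_inner y)

/-- Pairing with e^{-āt}y in L² reads off the Laplace transform at a, tested against y. On the
Fourier side the same pairing becomes integration against (a - iω)⁻¹. -/
theorem inner_toLp_expPos (y : X) (f : Lp X 2 (volume : Measure ℝ)) :
    inner ℂ ((memLp_expPos_smul (a := (starRingEnd ℂ) a) (by simpa using ha) y).toLp _) f =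
      inner ℂ y (∫ t in Set.Ioi (0 : ℝ), Complex.exp (-a * t) • f t) := by
  have h1 := integrable_exp_indicator_smul ha (Lp.memLp f)
  rw [← integral_indicator measurableSet_Ioi, ← integral_inner h1, L2.inner_def]
  refine integral_congr_ae ?_
  filter_upwards [(memLp_expPos_smul (a := (starRingEnd ℂ) a) (by simpa using ha) y).coeFn_toLp]
    with t ht
  rw [ht]
  by_cases h0 : 0 < t
  · simp [expPos, h0, inner_smul_left, inner_smul_right, ← Complex.exp_conj]
  · simp [expPos, h0]

theorem inner_fourier_toLp_expPos (y : X) (f : Lp X 2 (volume : Measure ℝ)) :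
    inner ℂ (𝓕 ((memLp_expPos_smul (a := (starRingEnd ℂ) a) (by simpa using ha) y).toLp _) :
      Lp X 2 (volume : Measure ℝ)) f = ∫ ξ, (a - axisPoint ξ)⁻¹ * inner ℂ y (f ξ) := by
  rw [L2.inner_def]
  refine integral_congr_ae ?_
  filter_upwards [fourier_toLp_expPos (a := (starRingEnd ℂ) a) (by simpa using ha) y] with ξ hξ
  rw [hξ, inner_smul_left, map_inv₀, map_add, Complex.conj_conj, conj_axisPoint, sub_eq_add_neg]

/-- The square integrable multiple of the conjugate of a boundary function has its inverse Fourier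
transform supported on `(0, ∞)`. -/
theorem fourierInv_conj_boundary_mem_L2Pos {g : HInfMinus} {b : Lp ℂ ∞ (volume : Measure ℝ)}
    (hb : IsBoundaryFunction g b) (y : X) {V : Lp X 2 (volume : Measure ℝ)}
    (hV : V =ᵐ[volume] fun ξ => (starRingEnd ℂ) (b ξ * (a - axisPoint ξ)⁻¹) • y) :
    (𝓕⁻ V : Lp X 2 (volume : Measure ℝ)) ∈ L2Pos X := by
  set v : Lp X 2 (volume : Measure ℝ) := 𝓕⁻ V with hv
  have hVv : (𝓕 v : Lp X 2 (volume : Measure ℝ)) = V := FourierTransform.fourier_fourierInv_eq V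
  have hneg := Measure.measurePreserving_neg (volume : Measure ℝ)
  have hvn : MemLp (fun t => v (-t)) 2 (volume : Measure ℝ) := (Lp.memLp v).comp_measurePreserving hneg
  -- The Laplace transform at c of the reflected function t ↦ v(-t) is, by Plancherel, the conjugate
  -- of the boundary integral of g(s)(a - s)⁻¹(c̄ - s)⁻¹ times ⟨z, y⟩. The two resolvent factors
  -- make the integrand integrable, so Cauchy's theorem gives zero.
  have key : ∀ᵐ t : ℝ, 0 < t → v (-t) = 0 := by
    refine ae_eq_zero_of_laplace_eq_zero hvn fun c hc => ?_
    have hc' : 0 < ((starRingEnd ℂ) c).re := by simpa using hc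
    refine ext_inner_left ℂ fun z => ?_
    rw [inner_zero_right]
    have hE1 : Integrable fun t => expPos ((starRingEnd ℂ) c) (-t) • z :=
      (integrable_expPos_smul hc' z).comp_neg
    have hE2 : MemLp (fun t => expPos ((starRingEnd ℂ) c) (-t) • z) 2 (volume : Measure ℝ) :=
      (memLp_expPos_smul hc' z).comp_measurePreserving hneg
    have hEF : ∀ ξ, 𝓕 (fun t => expPos ((starRingEnd ℂ) c) (-t) • z) ξ =
        ((starRingEnd ℂ) c - axisPoint ξ)⁻¹ • z := by
      intro ξ
      have h1 := fourier_expPos_smul hc' z (-ξ)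
      have h2 : axisPoint (-ξ) = -axisPoint ξ := by simp [axisPoint]
      rw [fourier_eq_integral_exp, h2, ← integral_neg_eq_self] at h1
      rw [fourier_eq_integral_exp, sub_eq_add_neg, ← h1]
      refine integral_congr_ae (Eventually.of_forall fun t => ?_)
      simp
    have hinner : inner ℂ z (∫ t in Set.Ioi (0 : ℝ), Complex.exp (-c * t) • v (-t)) =
        inner ℂ (hE2.toLp _) v := by
      have h1 := integrable_exp_indicator_smul hc hvn
      rw [← integral_indicator measurableSet_Ioi, ← integral_inner h1, L2.inner_def,
        ← integral_neg_eq_self]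
      refine integral_congr_ae ?_
      filter_upwards [hE2.coeFn_toLp] with t ht
      rw [ht]
      by_cases h0 : t < 0
      · simp [expPos, h0, inner_smul_left, inner_smul_right, ← Complex.exp_conj]
      · simp [expPos, h0]
    rw [hinner, ← Lp.inner_fourier_eq, hVv, L2.inner_def]
    have hprod : Integrable fun ξ => (a - axisPoint ξ)⁻¹ * ((starRingEnd ℂ) c - axisPoint ξ)⁻¹ :=
      (memLp_inv_sub_axisPoint ha).integrable_mul (memLp_inv_sub_axisPoint hc')
    have hzero : ∫ ξ, b ξ * ((a - axisPoint ξ)⁻¹ * ((starRingEnd ℂ) c - axisPoint ξ)⁻¹) = 0 := by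
      refine hb.integral_mul_eq_zero
        ((differentiableOn_inv_sub ha).mul (differentiableOn_inv_sub hc'))
        (M := a.re⁻¹ * ((starRingEnd ℂ) c).re⁻¹) (fun s hs => ?_) ?_
        (hprod.bdd_mul (Lp.aestronglyMeasurable b) hb.ae_norm_le)
      · have hs' : s.re ≤ 0 := le_of_lt hs
        simp only [Pi.mul_apply]
        rw [norm_mul]
        exact mul_le_mul (norm_inv_sub_le ha hs') (norm_inv_sub_le hc' hs') (norm_nonneg _)
          (inv_nonneg.2 ha.le)
      · filter_upwards [hasBoundaryValues_inv_sub ha, hasBoundaryValues_inv_sub hc'] with ξ h1 h2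
        exact h1.mul h2
    have hval : ∀ᵐ ξ, inner ℂ ((𝓕 (hE2.toLp _) : Lp X 2 (volume : Measure ℝ)) ξ) (V ξ) =
        (starRingEnd ℂ) (b ξ * ((a - axisPoint ξ)⁻¹ * ((starRingEnd ℂ) c - axisPoint ξ)⁻¹)) *
          inner ℂ z y := by
      filter_upwards [fourier_toLp_ae_eq hE1 hE2, hV] with ξ h1 h2
      rw [h1, h2, hEF, inner_smul_left, inner_smul_right]
      simp only [map_mul]
      ring
    rw [integral_congr_ae hval, integral_mul_const, integral_conj, hzero, map_zero, zero_mul]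
  rw [mem_L2Pos_iff]
  have hne : ∀ᵐ t : ℝ, t ≠ 0 := compl_mem_ae_iff.2 (measure_singleton 0)
  filter_upwards [hneg.quasiMeasurePreserving.ae key, hne] with t ht h0 ht0
  have := ht (neg_pos.2 (lt_of_le_of_ne ht0 h0))
  rwa [neg_neg] at this

end ExpPos

/-! ### The functional calculus of a dissipative generator -/

section Orthogonal

variable {X : Type*} [NormedAddCommGroup X] [InnerProductSpace ℂ X] [CompleteSpace X]

/-- The integral is the inner product of q with conj(b (a - iω)⁻¹)y, which lies in H₂. -/
theorem integral_boundary_mul_inner_orthogonal_eq_zero {a : ℂ} (ha : 0 < a.re) {g : HInfMinus}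
    {b : Lp ℂ ∞ (volume : Measure ℝ)} (hb : IsBoundaryFunction g b) (y : X)
    {q : Lp X 2 (volume : Measure ℝ)} (hq : q ∈ (H2 X)ᗮ) :
    ∫ ξ, b ξ * (a - axisPoint ξ)⁻¹ * inner ℂ y (q ξ) = 0 := by
  have hmem : MemLp (fun ξ => (starRingEnd ℂ) (b ξ * (a - axisPoint ξ)⁻¹) • y) 2
      (volume : Measure ℝ) := by
    refine (memLp_inv_sub_axisPoint ha).of_le_mul (c := ‖g‖ * ‖y‖) ?_ ?_
    · refine AEStronglyMeasurable.smul_const ?_ y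
      refine Complex.continuous_conj.comp_aestronglyMeasurable ?_
      exact (Lp.aestronglyMeasurable b).mul (memLp_inv_sub_axisPoint ha).1
    · filter_upwards [hb.ae_norm_le] with ξ hξ
      rw [norm_smul, Complex.norm_conj, norm_mul]
      calc ‖b ξ‖ * ‖(a - axisPoint ξ)⁻¹‖ * ‖y‖ ≤ ‖g‖ * ‖(a - axisPoint ξ)⁻¹‖ * ‖y‖ := by gcongr
        _ = _ := by ring
  have hV := hmem.coeFn_toLp
  have h1 : hmem.toLp _ ∈ H2 X := by
    have := fourier_mem_H2 (fourierInv_conj_boundary_mem_L2Pos ha hb y hV)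
    rwa [FourierTransform.fourier_fourierInv_eq] at this
  rw [← (Submodule.mem_orthogonal _ _).1 hq _ h1, L2.inner_def]
  refine integral_congr_ae ?_
  filter_upwards [hV] with ξ hξ
  rw [hξ, inner_smul_left, Complex.conj_conj]

end Orthogonal

namespace C0Semigroup.IsExponentiallyStable

variable {X : Type*} [NormedAddCommGroup X] [InnerProductSpace ℂ X] [CompleteSpace X]
  {T : C0Semigroup X} (hT : T.IsExponentiallyStable) {A : X →ₗ.[ℂ] X} (hA : T.IsGenerator A)

/-- Plancherel: both sides are the pairing of e^{-āt}y with the orbit of x, in the time and in the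
frequency variable. -/
theorem inner_res_eq_integral {a : ℂ} (ha : 0 < a.re) (y x : X) :
    inner ℂ y (hT.res a x) =
      ∫ ξ, (a - axisPoint ξ)⁻¹ * inner ℂ y (hT.res (axisPoint ξ) x) := by
  have h1 := inner_fourier_toLp_expPos ha y (𝓕 (T.orbitL2 hT x))
  rw [Lp.inner_fourier_eq, inner_toLp_expPos ha] at h1
  have h2 : hT.res a x = ∫ t in Set.Ioi (0 : ℝ), Complex.exp (-a * t) • (T.orbitL2 hT x) t := by
    rw [hT.res_apply ha.le]
    refine setIntegral_congr_ae measurableSet_Ioi ?_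
    filter_upwards [(hT.memLp_orbit x).coeFn_toLp] with t ht h0
    rw [orbitL2, ht, orbit, Set.indicator_of_mem h0, laplaceIntegrand]
  rw [h2, h1]
  refine integral_congr_ae ?_
  filter_upwards [hT.fourier_orbitL2 x] with ξ hξ
  rw [hξ]

variable (hd : IsDissipativeOp A)

/-- The bounded operator `g(A)`. -/
noncomputable def hInfCalc (hA : T.IsGenerator A) (hd : IsDissipativeOp A) (g : HInfMinus) : X →L[ℂ] X :=
  (hT.exists_clm_inner_eq_integral hA hd
    (Lp.aestronglyMeasurable (exists_isBoundaryFunction g).choose)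
    (exists_isBoundaryFunction g).choose_spec.ae_norm_le).choose

theorem norm_hInfCalc_le (g : HInfMinus) : ‖hT.hInfCalc hA hd g‖ ≤ ‖g‖ :=
  (hT.exists_clm_inner_eq_integral hA hd
    (Lp.aestronglyMeasurable (exists_isBoundaryFunction g).choose)
    (exists_isBoundaryFunction g).choose_spec.ae_norm_le).choose_spec.2

/-- Boundary values are unique almost everywhere, so the choice made in the definition of `hInfCalc`
is immaterial. -/
theorem inner_hInfCalc_of_hasBoundaryValues {g : HInfMinus} {β : ℝ → ℂ}
    (hβ : HasBoundaryValues (zeroExtend g.1) β) (y x : X) :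
    inner ℂ y (hT.hInfCalc hA hd g x) = ∫ ξ, β ξ * hT.poissonForm y x ξ := by
  refine ((hT.exists_clm_inner_eq_integral hA hd
    (Lp.aestronglyMeasurable (exists_isBoundaryFunction g).choose)
    (exists_isBoundaryFunction g).choose_spec.ae_norm_le).choose_spec.1 y x).trans ?_
  refine integral_congr_ae ?_
  filter_upwards [(exists_isBoundaryFunction g).choose_spec.ae_eq_of_tendsto hβ] with ξ hξ
  rw [hξ]

theorem inner_hInfCalc_res {g : HInfMinus} {b : Lp ℂ ∞ (volume : Measure ℝ)}
    (hb : IsBoundaryFunction g b) {a : ℂ} (ha : 0 < a.re) (y x : X) :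
    inner ℂ y (hT.hInfCalc hA hd g (hT.res a x)) =
      ∫ ξ, b ξ * (a - axisPoint ξ)⁻¹ * inner ℂ y (hT.res (axisPoint ξ) x) := by
  have hi1 := hT.integrable_mul_poissonForm hA hd (Lp.aestronglyMeasurable b) hb.ae_norm_le
    y (hT.res a x)
  have hi2 : Integrable fun ξ => b ξ * (a - axisPoint ξ)⁻¹ * inner ℂ y (hT.res (axisPoint ξ) x) := by
    simp only [mul_assoc]
    exact (integrable_inv_sub_mul_inner ha y (hT.memLp_res_axisPoint x)).bdd_mul
      (Lp.aestronglyMeasurable b) hb.ae_norm_le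
  rw [hT.inner_hInfCalc_of_hasBoundaryValues hA hd hb.hasBoundaryValues, ← sub_eq_zero,
    ← integral_sub hi1 hi2]
  -- The resolvent identity rewrites ⟨y, R(iω)R(a)x⟩ so that the terms in ⟨y, R(iω)x⟩ cancel. What
  -- remains multiplying b is the boundary value of a bounded analytic function, so its integral
  -- vanishes.
  have heq : ∀ ξ, b ξ * hT.poissonForm y (hT.res a x) ξ -
      b ξ * (a - axisPoint ξ)⁻¹ * inner ℂ y (hT.res (axisPoint ξ) x) =
      b ξ * (inner ℂ (hT.res (axisPoint ξ) y) (hT.res a x) -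
        (a - axisPoint ξ)⁻¹ * inner ℂ y (hT.res a x)) := by
    intro ξ
    have h1 := congrArg (fun z => (inner ℂ y z : ℂ))
      (hT.res_sub_res hA (a := axisPoint ξ) (b := a) (by simp) ha.le x)
    simp only [inner_sub_right, inner_smul_right] at h1
    have hne : a - axisPoint ξ ≠ 0 := sub_ne_zero_of_re_pos ha (by simp)
    have h2 : inner ℂ y (hT.res (axisPoint ξ) (hT.res a x)) =
        (a - axisPoint ξ)⁻¹ * (inner ℂ y (hT.res (axisPoint ξ) x) - inner ℂ y (hT.res a x)) := by
      rw [eq_inv_mul_iff_mul_eq₀ hne]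
      linear_combination h1
    rw [poissonForm, h2]
    ring
  have hi3 := hi1.sub hi2
  simp only [heq]
  obtain ⟨C, hC⟩ := hT.exists_norm_inner_res_le y (hT.res a x)
  refine hb.integral_mul_eq_zero
    (F := fun s => inner ℂ (hT.res (-(starRingEnd ℂ) s) y) (hT.res a x) -
      (a - s)⁻¹ * inner ℂ y (hT.res a x))
    (M := C + a.re⁻¹ * ‖(inner ℂ y (hT.res a x) : ℂ)‖)
    ((hT.differentiableOn_inner_res hA y _).sub ((differentiableOn_inv_sub ha).mul_const _))
    (fun s hs => (norm_sub_le _ _).trans (add_le_add (hC s) ?_)) ?_ ?_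
  · rw [norm_mul]
    gcongr
    exact norm_inv_sub_le ha (le_of_lt hs)
  · filter_upwards [hT.hasBoundaryValues_inner_res hA y (hT.res a x),
      hasBoundaryValues_inv_sub ha] with ξ h1 h2
    exact h1.sub (h2.mul_const _)
  · exact hi3.congr (Eventually.of_forall heq)

/-- Both sides have the same Laplace transform: for M_g(T(·)x) the pairing with e^{-āt}y removes Π
and gives ∫ b (a - iω)⁻¹⟨y, R(iω)x⟩, which `inner_hInfCalc_res` identifies with ⟨y, g(A)R(a)x⟩. -/
theorem toeplitz_orbitL2 {g : HInfMinus} {b : Lp ℂ ∞ (volume : Measure ℝ)}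
    (hb : IsBoundaryFunction g b) (x : X) :
    ∀ᵐ t : ℝ, 0 < t → toeplitz b (T.orbitL2 hT x) t = hT.hInfCalc hA hd g (T.op t.toNNReal x) := by
  set f := toeplitz b (T.orbitL2 hT x) with hf
  have hΦ : MemLp (fun t => hT.hInfCalc hA hd g (T.orbit x t)) 2 (volume : Measure ℝ) :=
    (hT.hInfCalc hA hd g).comp_memLp' (hT.memLp_orbit x)
  have hmem : MemLp (fun t => f t - hT.hInfCalc hA hd g (T.orbit x t)) 2 (volume : Measure ℝ) :=
    (Lp.memLp f).sub hΦ
  have key := ae_eq_zero_of_laplace_eq_zero hmem fun a ha => by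
    refine ext_inner_left ℂ fun y => ?_
    rw [inner_zero_right]
    have hI1 := integrable_exp_indicator_smul ha (Lp.memLp f)
    have hI2 := integrable_exp_indicator_smul ha hΦ
    rw [integrable_indicator_iff measurableSet_Ioi] at hI1 hI2
    simp only [smul_sub]
    rw [integral_sub hI1 hI2, inner_sub_right, sub_eq_zero, ← inner_toLp_expPos ha, hf,
      inner_toeplitz _ _ (expPos_mem_L2Pos (by simpa using ha) y), inner_fourier_toLp_expPos ha]
    have h1 : ∫ t in Set.Ioi (0 : ℝ), Complex.exp (-a * t) • hT.hInfCalc hA hd g (T.orbit x t) =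
        hT.hInfCalc hA hd g (hT.res a x) := by
      rw [hT.map_res_apply _ ha.le]
      refine setIntegral_congr_fun measurableSet_Ioi fun t ht => ?_
      simp only [orbit, Set.indicator_of_mem ht, laplaceIntegrand, map_smul]
    rw [h1, hT.inner_hInfCalc_res hA hd hb ha]
    refine integral_congr_ae ?_
    filter_upwards [hT.fourier_orbitL2 x,
      Lp.coeFn_lpSMul (r := 2) b (𝓕 (T.orbitL2 hT x) : Lp X 2 (volume : Measure ℝ))] with ξ h2 h3
    rw [h3, Pi.smul_apply', h2, inner_smul_right]
    ring
  filter_upwards [key] with t ht h0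
  have := sub_eq_zero.1 (ht h0)
  rwa [orbit, Set.indicator_of_mem (Set.mem_Ioi.2 h0)] at this

theorem toeplitz_orbitL2_eq_toLp {g : HInfMinus} {b : Lp ℂ ∞ (volume : Measure ℝ)}
    (hb : IsBoundaryFunction g b) (x : X) :
    toeplitz b (T.orbitL2 hT x) =
      ((hT.hInfCalc hA hd g).comp_memLp' (hT.memLp_orbit x)).toLp _ := by
  have hpos : toeplitz b (T.orbitL2 hT x) ∈ L2Pos X :=
    fourierInv_mem_L2Pos (Submodule.starProjection_apply_mem _ _)
  refine Lp.ext ?_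
  filter_upwards [(mem_L2Pos_iff _).1 hpos, hT.toeplitz_orbitL2 hA hd hb x,
    ((hT.hInfCalc hA hd g).comp_memLp' (hT.memLp_orbit x)).coeFn_toLp] with t h1 h2 h3
  rw [h3]
  rcases lt_or_ge 0 t with h0 | h0
  · rw [h2 h0, Function.comp_apply, orbit, Set.indicator_of_mem (Set.mem_Ioi.2 h0)]
  · rw [h1 h0, Function.comp_apply, orbit, Set.indicator_of_notMem (by simpa using h0), map_zero]

/-- This computes Π(b R(iω)x) = g(A)R(iω)x pointwise on the axis, the form needed for
multiplicativity. -/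
theorem fourier_toeplitz_orbitL2 {g : HInfMinus} {b : Lp ℂ ∞ (volume : Measure ℝ)}
    (hb : IsBoundaryFunction g b) (x : X) :
    (𝓕 (toeplitz b (T.orbitL2 hT x)) : Lp X 2 (volume : Measure ℝ)) =ᵐ[volume]
      fun ξ => hT.hInfCalc hA hd g (hT.res (axisPoint ξ) x) := by
  rw [hT.toeplitz_orbitL2_eq_toLp hA hd hb x]
  refine (fourier_toLp_ae_eq ((hT.hInfCalc hA hd g).integrable_comp (hT.integrable_orbit x)) _).trans ?_
  refine Eventually.of_forall fun ξ => ?_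
  rw [fourier_eq_integral_exp]
  simp only [← map_smul]
  rw [← hT.fourier_orbit, fourier_eq_integral_exp]
  refine (hT.hInfCalc hA hd g).integral_comp_comm ?_
  refine (hT.integrable_orbit x).bdd_smul 1
    (Continuous.aestronglyMeasurable (by fun_prop)) (Eventually.of_forall fun t => ?_)
  rw [norm_cexp_neg_mul]
  simp

theorem hInfCalc_mul (g h : HInfMinus) :
    hT.hInfCalc hA hd (g * h) = hT.hInfCalc hA hd g * hT.hInfCalc hA hd h := by
  obtain ⟨b, hb⟩ := exists_isBoundaryFunction g
  obtain ⟨c, hc⟩ := exists_isBoundaryFunction h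
  obtain ⟨d, hgh⟩ := exists_isBoundaryFunction (g * h)
  have hbc : ∀ᵐ ξ, d ξ = b ξ * c ξ := hgh.ae_eq_of_tendsto (by
    filter_upwards [hb.hasBoundaryValues, hc.hasBoundaryValues] with ξ h1 h2
    refine (h1.mul h2).congr fun σ => ?_
    simp only [zeroExtend]
    split_ifs <;> simp)
  refine hT.clm_ext_of_comp_res (a := 1) (by simp) fun x => ext_inner_left ℂ fun y => ?_
  have ha : 0 < (1 : ℂ).re := by simp
  set P : Lp X 2 (volume : Measure ℝ) := b • (𝓕 (T.orbitL2 hT x) : Lp X 2 (volume : Measure ℝ))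
    with hP
  -- The part of b R(iω)x that Π discards is invisible to c (1 - iω)⁻¹. Hence integrating bc against
  -- R(iω)x equals integrating c against g(A)R(iω)x, and moving g(A) to y by the adjoint produces
  -- g(A)h(A).
  have hq : P - 𝓕 (toeplitz b (T.orbitL2 hT x)) ∈ (H2 X)ᗮ := by
    rw [fourier_toeplitz]
    exact Submodule.sub_starProjection_mem_orthogonal P
  have h0 := integral_boundary_mul_inner_orthogonal_eq_zero ha hc y hq
  have hsplit : ∀ᵐ ξ, c ξ * (1 - axisPoint ξ)⁻¹ *
      inner ℂ y ((P - 𝓕 (toeplitz b (T.orbitL2 hT x)) : Lp X 2 (volume : Measure ℝ)) ξ) =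
      d ξ * (1 - axisPoint ξ)⁻¹ * inner ℂ y (hT.res (axisPoint ξ) x) -
      c ξ * (1 - axisPoint ξ)⁻¹ * inner ℂ (ContinuousLinearMap.adjoint (hT.hInfCalc hA hd g) y)
        (hT.res (axisPoint ξ) x) := by
    filter_upwards [hbc, Lp.coeFn_sub P (𝓕 (toeplitz b (T.orbitL2 hT x))),
      hT.fourier_toeplitz_orbitL2 hA hd hb x, hT.fourier_orbitL2 x,
      Lp.coeFn_lpSMul (r := 2) b (𝓕 (T.orbitL2 hT x) : Lp X 2 (volume : Measure ℝ))]
      with ξ h1 h2 h3 h4 h5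
    rw [h2, Pi.sub_apply, h3, hP, h5, Pi.smul_apply', h4, inner_sub_right, inner_smul_right, h1,
      ContinuousLinearMap.adjoint_inner_left]
    ring
  have hint : ∀ (k : HInfMinus) (e : Lp ℂ ∞ (volume : Measure ℝ)), IsBoundaryFunction k e → ∀ z : X,
      Integrable fun ξ => e ξ * (1 - axisPoint ξ)⁻¹ * inner ℂ z (hT.res (axisPoint ξ) x) := by
    intro k e he z
    simp only [mul_assoc]
    exact (integrable_inv_sub_mul_inner ha z (hT.memLp_res_axisPoint x)).bdd_mul
      (Lp.aestronglyMeasurable e) he.ae_norm_le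
  rw [integral_congr_ae hsplit, integral_sub (hint _ _ hgh y) (hint _ _ hc _), sub_eq_zero,
    ← hT.inner_hInfCalc_res hA hd hgh ha, ← hT.inner_hInfCalc_res hA hd hc ha,
    ContinuousLinearMap.adjoint_inner_left] at h0
  exact h0

/-- The total mass of the Poisson form is only known as an inequality on the diagonal, so the
identity is checked on the range of the resolvent, where the integral recovers R(1). -/
theorem hInfCalc_one : hT.hInfCalc hA hd 1 = 1 := by
  obtain ⟨b, hb⟩ := exists_isBoundaryFunction 1
  refine hT.clm_ext_of_comp_res (a := 1) (by simp) fun x => ext_inner_left ℂ fun y => ?_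
  rw [hT.inner_hInfCalc_res hA hd hb (by simp), one_apply_eq_self,
    hT.inner_res_eq_integral (by simp)]
  have hb1 : ∀ᵐ ξ, b ξ = 1 := hb.ae_eq_of_tendsto
    (hasBoundaryValues_of_eqOn (F := fun _ => 1) (fun s hs => by rw [zeroExtend_of_mem _ hs]; simp)
      (Eventually.of_forall fun ξ => tendsto_const_nhds))
  refine integral_congr_ae ?_
  filter_upwards [hb1] with ξ hξ
  rw [hξ, one_mul]

theorem hInfCalc_add (g h : HInfMinus) :
    hT.hInfCalc hA hd (g + h) = hT.hInfCalc hA hd g + hT.hInfCalc hA hd h := by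
  obtain ⟨b, hb⟩ := exists_isBoundaryFunction g
  obtain ⟨c, hc⟩ := exists_isBoundaryFunction h
  have hbc : HasBoundaryValues (zeroExtend (g + h).1) fun ξ => b ξ + c ξ := by
    filter_upwards [hb.hasBoundaryValues, hc.hasBoundaryValues] with ξ h1 h2
    refine (h1.add h2).congr fun σ => ?_
    simp only [zeroExtend]
    split_ifs <;> simp
  ext x
  refine ext_inner_left ℂ fun y => ?_
  rw [add_apply, inner_add_right, hT.inner_hInfCalc_of_hasBoundaryValues hA hd hbc,
    hT.inner_hInfCalc_of_hasBoundaryValues hA hd hb.hasBoundaryValues,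
    hT.inner_hInfCalc_of_hasBoundaryValues hA hd hc.hasBoundaryValues,
    ← integral_add
      (hT.integrable_mul_poissonForm hA hd (Lp.aestronglyMeasurable b) hb.ae_norm_le y x)
      (hT.integrable_mul_poissonForm hA hd (Lp.aestronglyMeasurable c) hc.ae_norm_le y x)]
  simp only [add_mul]

theorem hInfCalc_smul (r : ℂ) (g : HInfMinus) :
    hT.hInfCalc hA hd (r • g) = r • hT.hInfCalc hA hd g := by
  obtain ⟨b, hb⟩ := exists_isBoundaryFunction g
  have hrb : HasBoundaryValues (zeroExtend (r • g).1) fun ξ => r * b ξ := by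
    filter_upwards [hb.hasBoundaryValues] with ξ h1
    refine (h1.const_mul r).congr fun σ => ?_
    simp only [zeroExtend]
    split_ifs <;> simp
  ext x
  refine ext_inner_left ℂ fun y => ?_
  rw [smul_apply, inner_smul_right, hT.inner_hInfCalc_of_hasBoundaryValues hA hd hrb,
    hT.inner_hInfCalc_of_hasBoundaryValues hA hd hb.hasBoundaryValues, ← integral_const_mul]
  simp only [mul_assoc]

/-- The decay of (a - iω)⁻¹ lets the two halves of the Poisson form be integrated separately: the
conjugate half vanishes by Cauchy's theorem, and the other half is the formula for ⟨y, R(a)x⟩. -/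
theorem hInfCalc_eq_res {a : ℂ} (ha : 0 < a.re) {g : HInfMinus}
    (hg : ∀ s : leftHalfPlane, g.1 s = (a - s)⁻¹) : hT.hInfCalc hA hd g = hT.res a := by
  obtain ⟨b, hb⟩ := exists_isBoundaryFunction g
  have hba : ∀ᵐ ξ, b ξ = (a - axisPoint ξ)⁻¹ := hb.ae_eq_of_tendsto
    (hasBoundaryValues_of_eqOn (fun s hs => by rw [zeroExtend_of_mem _ hs, hg])
      (hasBoundaryValues_inv_sub ha))
  ext x
  refine ext_inner_left ℂ fun y => ?_
  have hL2 : MemLp (fun ξ => inner ℂ (hT.res (axisPoint ξ) y) x) 2 (volume : Measure ℝ) :=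
    (hT.memLp_res_axisPoint y).inner_const x
  have hi1 := integrable_inv_sub_mul_inner ha y (hT.memLp_res_axisPoint x)
  have hi2 : Integrable fun ξ => (a - axisPoint ξ)⁻¹ * inner ℂ (hT.res (axisPoint ξ) y) x :=
    (memLp_inv_sub_axisPoint ha).integrable_mul hL2
  have hcong : (fun ξ => b ξ * inner ℂ (hT.res (axisPoint ξ) y) x) =ᵐ[volume]
      fun ξ => (a - axisPoint ξ)⁻¹ * inner ℂ (hT.res (axisPoint ξ) y) x := by
    filter_upwards [hba] with ξ hξ
    rw [hξ]
  obtain ⟨C, hC⟩ := hT.exists_norm_inner_res_le y x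
  have h0 := hb.integral_mul_eq_zero (hT.differentiableOn_inner_res hA y x) (fun s _ => hC s)
    (hT.hasBoundaryValues_inner_res hA y x) (hi2.congr hcong.symm)
  rw [integral_congr_ae hcong] at h0
  rw [hT.inner_hInfCalc_of_hasBoundaryValues hA hd hb.hasBoundaryValues,
    hT.inner_res_eq_integral ha, ← add_zero (∫ ξ, _ * inner ℂ y _), ← h0, ← integral_add hi1 hi2]
  refine integral_congr_ae ?_
  filter_upwards [hba] with ξ hξ
  rw [hξ, poissonForm, mul_add]

/-- The `H^∞` functional calculus of a dissipative generator as an algebra homomorphism. -/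
noncomputable def hInfCalcHom (hA : T.IsGenerator A) (hd : IsDissipativeOp A) :
    HInfMinus →ₐ[ℂ] (X →L[ℂ] X) :=
  AlgHom.ofLinearMap
    { toFun := hT.hInfCalc hA hd
      map_add' := hT.hInfCalc_add hA hd
      map_smul' := hT.hInfCalc_smul hA hd }
    (hT.hInfCalc_one hA hd) (hT.hInfCalc_mul hA hd)

theorem isFunctionOfGenerator_hInfCalc (g : HInfMinus) :
    IsFunctionOfGenerator A T hT g ((hT.hInfCalc hA hd g).toLinearMap ∘ₗ A.domain.subtype) := by
  obtain ⟨b, hb⟩ := exists_isBoundaryFunction g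
  refine ⟨⟨‖hT.hInfCalc hA hd g‖, fun x => ?_⟩, b, hb, fun x => ?_⟩
  · refine ((hT.hInfCalc hA hd g).le_opNorm x).trans ?_
    gcongr
    exact le_add_of_nonneg_right (norm_nonneg _)
  · filter_upwards [hT.toeplitz_orbitL2 hA hd hb x] with t ht h0
    obtain ⟨z, hz, -⟩ := (LinearPMap.mem_graph_iff _).1
      (op_mem_graph hA t.toNNReal (A.mem_graph x))
    refine ⟨z, hz, ?_⟩
    rw [ht h0]
    simp only at hz
    simp [hz]

/-- The two maps agree on T(t)x for almost every t > 0. As t ↓ 0, T(t)x tends to x in the graph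
norm, for which both are continuous. -/
theorem eq_hInfCalc_of_isFunctionOfGenerator {g : HInfMinus} {C : A.domain →ₗ[ℂ] X}
    (hC : IsFunctionOfGenerator A T hT g C) (x : A.domain) : C x = hT.hInfCalc hA hd g x := by
  obtain ⟨⟨K, hK⟩, b, hb, hCb⟩ := hC
  have hgr : ∀ t : ℝ, ∃ z : A.domain, (z : X) = T.op t.toNNReal x ∧ A z = T.op t.toNNReal (A x) :=
    fun t => (LinearPMap.mem_graph_iff _).1 (op_mem_graph hA t.toNNReal (A.mem_graph x))
  choose z hz hAz using hgr
  have hae : ∀ᵐ t : ℝ, 0 < t → C (z t) = hT.hInfCalc hA hd g (T.op t.toNNReal x) := by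
    filter_upwards [hT.toeplitz_orbitL2 hA hd hb x, hCb x] with t h1 h2 h0
    obtain ⟨w, hw, hw'⟩ := h2 h0
    have : z t = w := Subtype.ext (by rw [hz, hw])
    rw [this, ← hw', h1 h0]
  have h0 : ∀ y : X, Tendsto (fun t : ℝ => T.op t.toNNReal y) (𝓝[>] 0) (𝓝 y) := fun y => by
    have := ((T.continuous_op_toNNReal y).tendsto 0).mono_left (nhdsWithin_le_nhds (s := Set.Ioi 0))
    simpa [T.op_zero] using this
  -- The exceptional null set cannot contain an interval (0, δ), so agreement occurs at arbitrarily
  -- small t.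
  have hfreq : ∃ᶠ t : ℝ in 𝓝[>] 0, C (z t) = hT.hInfCalc hA hd g (T.op t.toNNReal x) := by
    have h1 : ∀ᵐ t ∂(volume.restrict (Set.Ioi (0 : ℝ))),
        C (z t) = hT.hInfCalc hA hd g (T.op t.toNNReal x) :=
      (ae_restrict_iff' measurableSet_Ioi).2 hae
    intro hnot
    obtain ⟨δ, hδ, hsub⟩ := mem_nhdsGT_iff_exists_Ioo_subset.1 hnot
    have h2 := hae
    rw [ae_iff] at h2
    have h3 : Set.Ioo 0 δ ⊆
        {t : ℝ | ¬(0 < t → C (z t) = hT.hInfCalc hA hd g (T.op t.toNNReal x))} := fun t ht h4 =>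
      hsub ht (h4 ht.1)
    have h5 := measure_mono_null h3 h2
    rw [Real.volume_Ioo, ENNReal.ofReal_eq_zero] at h5
    have : (0 : ℝ) < δ := hδ
    linarith
  have hCz : Tendsto (fun t => C (z t)) (𝓝[>] 0) (𝓝 (C x)) := by
    rw [tendsto_iff_norm_sub_tendsto_zero]
    have hlim : Tendsto (fun t : ℝ => K * (‖T.op t.toNNReal (x : X) - x‖ +
        ‖T.op t.toNNReal (A x) - A x‖)) (𝓝[>] 0) (𝓝 0) := by
      have h1 := tendsto_iff_norm_sub_tendsto_zero.1 (h0 (x : X))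
      have h2 := tendsto_iff_norm_sub_tendsto_zero.1 (h0 (A x))
      simpa using (h1.add h2).const_mul K
    refine squeeze_zero (fun t => norm_nonneg _) (fun t => ?_) hlim
    have := hK (z t - x)
    rwa [map_sub, LinearPMap.map_sub, hAz, Submodule.coe_sub, hz] at this
  have hΦ := ((hT.hInfCalc hA hd g).continuous.tendsto _).comp (h0 (x : X))
  have hdiff := hCz.sub hΦ
  refine sub_eq_zero.1 ?_
  by_contra hne
  have hev := hdiff.eventually_ne hne
  obtain ⟨t, ht, ht'⟩ := (hfreq.and_eventually hev).exists
  exact ht' (sub_eq_zero.2 ht)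

end C0Semigroup.IsExponentiallyStable

theorem corollaryC3p3 {X : Type*} [NormedAddCommGroup X] [InnerProductSpace ℂ X] [CompleteSpace X]
    [TopologicalSpace.SeparableSpace X] (A : X →ₗ.[ℂ] X) (T : C0Semigroup X)
    (hgen : T.IsGenerator A) (hstab : T.IsExponentiallyStable) (hdiss : IsDissipativeOp A) :
    ∃ Φ : HInfMinus →ₐ[ℂ] (X →L[ℂ] X),
      IsBoundedHInfCalculus A T hstab Φ ∧
      (∀ (g : HInfMinus) (C : A.domain →ₗ[ℂ] X), IsFunctionOfGenerator A T hstab g C →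
        ∀ x : A.domain, C x = Φ g x) ∧
      ∀ g : HInfMinus, ‖Φ g‖ ≤ ‖g‖ := by
  refine ⟨hstab.hInfCalcHom hgen hdiss,
    ⟨hstab.isFunctionOfGenerator_hInfCalc hgen hdiss, fun a g ha hg => ?_⟩,
    fun g C hC x => hstab.eq_hInfCalc_of_isFunctionOfGenerator hgen hdiss hC x,
    hstab.norm_hInfCalc_le hgen hdiss⟩
  have hres : hstab.hInfCalcHom hgen hdiss g = hstab.res a :=
    hstab.hInfCalc_eq_res hgen hdiss ha hg
  rw [hres]
  refine ⟨fun x => hstab.res_apply_of_mem_graph hgen ha.le (A.mem_graph x), fun y => ?_⟩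
  obtain ⟨x, hx, hAx⟩ := (LinearPMap.mem_graph_iff _).1 (hstab.res_mem_graph hgen ha.le y)
  refine ⟨x, hx, ?_⟩
  rw [hAx, hx]
  exact sub_sub_cancel _ _
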